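/- **Corollary (Computational Complexity).** Let $(\mathcal S,\mathcal A,\mathrm P,\mathrm r,\gamma)$ be a fully known discounted MDP with finite non-empty $\mathcal S,\mathcal A$, transition probabilities $p_{ij}^a$, rewards $r_{ij}^a\in[0,1]$ and $\gamma\in(0,1)$. A policy is a map $\pi:\mathcal S\to\mathcal A$, $v^\pi_i=\mathbb E^\pi[\sum_{t\ge0}\gamma^t r^{a_t}_{s_ts_{t+1}}\mid s_0=i]$, $v^*_i=\max_\pi v^\pi_i$, and $\pi$ is $\varepsilon$-optimal if $\|v^*-v^\pi\|_\infty\le\varepsilon$. Cost is the number of elementary steps of a random access machine with exact real arithmetic, in which each arithmetic operation, comparison, assignment, memory access and draw of a uniform number from $[0,1]$ costs $1$; $\tilde{\mathcal O}(f)$ means $C f\,(\log(2+f))^{p}$. There are a constant $p$ and, for each $C_0$, a constant $C$, depending on nothing else, such that the following hold. 1. *Preprocessing.* From $\mathrm P,\mathrm r$ one builds (by storing partial sums of each row of $\mathrm P$), in time $\tilde{\mathcal O}(|\mathcal S|^2|\mathcal A|)$, a generative model $\mathrm{GM}$: a call $\mathrm{GM}(i,a)$ uses one fresh uniform number, returns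 $j$ with probability exactly $p^a_{ij}$ together with $r^a_{ij}$, and costs at most $C(\log(2+|\mathcal S||\mathcal A|))^p$. 2. *AsyncQVI.* Let $0<\varepsilon<(1-\gamma)^{-1}$ and $0<\delta<1$, and let $B_1,B_2\ge1$ be integers with $B_1+B_2\le C_0|\mathcal S||\mathcal A|$. Put $$L=\Big\lceil 2B_1+\tfrac{B_1+B_2-1}{1-\gamma}\log\tfrac{2}{(1-\gamma)\varepsilon}\Big\rceil,\qquad K=\Big\lceil\tfrac{8}{(1-\gamma)^4\varepsilon^2}\log\tfrac{4L}{\delta}\Big\rceil .$$ AsyncQVI starts from $v=0$ and $\pi=0$ (the first action in every state). In iteration $t=0,\dots,L-1$ a pair $(i_t,a_t)$ is selected, $\mathrm{GM}(i_t,a_t)$ is called $K$ times with results $(s'_k,r_k)$, and $$q=\tfrac1K\sum_k r_k+\gamma\,\tfrac1K\sum_k\hat v_{s'_k}-\tfrac{(1-\gamma)\varepsilon}{4},\qquad \hat v_j=v_j(\tau_j(t)),$$ is computed, where $v(s)$ is the vector $v$ at the start of iteration $s$ and only the entries $\hat v_{s'_k}$ that are needed are read; if $q>v_{i_t}$, then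 $v_{i_t}\leftarrow q$ and $\pi_{i_t}\leftarrow a_t$. Suppose that, almost surely, (a) every pair $(i,a)$ is selected at least once in any $B_1$ consecutive iterations, and (b) $t-B_2<\tau_j(t)\le t$ for all $j,t$. Here $(i_t,a_t)$ and $\tau(t)$ may be random and may depend on the past, but the samples of iteration $t$ are independent of them and of the past. Then the vector $\pi$ after $L$ iterations is an $\varepsilon$-optimal policy with probability at least $1-\delta$, and the total cost, over all agents and including the preprocessing, is always $$\tilde{\mathcal O}\Big(|\mathcal S|^2|\mathcal A|+\frac{|\mathcal S||\mathcal A|}{(1-\gamma)^5\varepsilon^2}\log\frac2\delta\Big).$$ (For $\delta\le 1/2$, $\log(2/\delta)\le2\log(1/\delta)$, so $\log(2/\delta)$ may be replaced by $\log(1/\delta)$.) -/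

import Mathlib

open MeasureTheory ProbabilityTheory

namespace AsyncQVI

/-! ## Discounted Markov decision processes -/

/-- A DMDP with state space `Fin n` and action space `Fin m`: transition probabilities `P i a j`,
instant rewards `r i a j` in `[0,1]`, discount factor `γ` in `(0,1)`. -/
structure DMDP (n m : ℕ) where
  P : Fin n → Fin m → Fin n → ℝ
  P_nonneg : ∀ i a j, 0 ≤ P i a j
  P_sum : ∀ i a, ∑ j, P i a j = 1
  r : Fin n → Fin m → Fin n → ℝ
  r_mem : ∀ i a j, r i a j ∈ Set.Icc (0 : ℝ) 1
  γ : ℝ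
  γ_pos : 0 < γ
  γ_lt_one : γ < 1

namespace DMDP

variable {n m : ℕ}

/-- The one-step transition kernel on states under the policy `π`. -/
noncomputable def stepKernel (M : DMDP n m) (π : Fin n → Fin m) : Kernel (Fin n) (Fin n) :=
  Kernel.ofFunOfCountable fun i => ∑ j, ENNReal.ofReal (M.P i (π i) j) • Measure.dirac j

instance (M : DMDP n m) (π : Fin n → Fin m) : IsMarkovKernel (M.stepKernel π) := by
  refine ⟨fun i => ⟨?_⟩⟩
  change (∑ j, ENNReal.ofReal (M.P i (π i) j) • Measure.dirac j : Measure (Fin n)) Set.univ = 1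
  simp only [Measure.coe_finsetSum, Finset.sum_apply, Measure.smul_apply, measure_univ,
    smul_eq_mul, mul_one]
  rw [← ENNReal.ofReal_sum_of_nonneg fun j _ => M.P_nonneg i (π i) j, M.P_sum, ENNReal.ofReal_one]

/-- The law of the state trajectory `(s₀, s₁, …)` under the policy `π`, started at `s₀ = i`. -/
noncomputable def trajectoryLaw (M : DMDP n m) (π : Fin n → Fin m) (i : Fin n) :
    Measure (ℕ → Fin n) :=
  Kernel.traj (X := fun _ => Fin n)
    (fun t => (M.stepKernel π).comap (fun h => h ⟨t, Finset.mem_Iic.2 le_rfl⟩)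
      (measurable_pi_apply _)) 0 (fun _ => i)

/-- The state-value vector of `π`: the expected discounted sum of rewards from each state. -/
noncomputable def value (M : DMDP n m) (π : Fin n → Fin m) (i : Fin n) : ℝ :=
  ∫ s, ∑' t : ℕ, M.γ ^ t * M.r (s t) (π (s t)) (s (t + 1)) ∂(M.trajectoryLaw π i)

/-- The optimal value vector: the componentwise maximum of the values of the (finitely many)
policies. -/
noncomputable def optimalValue (M : DMDP n m) (i : Fin n) : ℝ :=
  ⨆ π : Fin n → Fin m, M.value π i

/-- `π` is `ε`-optimal; the norm on `Fin n → ℝ` is the sup norm. -/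
def IsEpsOptimal (M : DMDP n m) (ε : ℝ) (π : Fin n → Fin m) : Prop :=
  ‖M.optimalValue - M.value π‖ ≤ ε

end DMDP

/-! ## A random access machine with real arithmetic and a step count

The machine has finitely many index registers (holding naturals) and real registers, and
random-access arrays of reals and of naturals. Each arithmetic operation, array access, assignment,
comparison, loop round and draw of a uniform random number costs one unit of time. -/

/-- Index registers. -/
inductive NReg
  | numS | numA | numK | i | a | j | k | b | row | lo | hi | mid | width | depth
  deriving DecidableEq

/-- Real registers. -/
inductive RReg
  | gamma | eps | acc | u | rew | sumR | sumV | q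
  deriving DecidableEq

/-- Real arrays. `prob` and `reward` hold the input, `cum` is built by the preprocessing, `value` is
the shared vector `v`, and `view` gives an agent access to the (possibly stale) entries of `v` that
are visible to it during its current iteration. -/
inductive RArr
  | prob | reward | cum | value | view
  deriving DecidableEq

/-- Arrays of naturals. `policy` is the shared vector `π`. -/
inductive NArr
  | policy
  deriving DecidableEq

/-- A machine state. `pos` is the number of random numbers drawn from the current tape and `time`
is the number of elementary steps made so far. -/
structure State where
  nreg : NReg → ℕ
  rreg : RReg → ℝ
  rarr : RArr → ℕ → ℝ
  narr : NArr → ℕ → ℕ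
  pos : ℕ
  time : ℕ

/-- Index expressions; `half e` is `⌊e / 2⌋`. -/
inductive NExp
  | lit (c : ℕ)
  | reg (x : NReg)
  | add (e f : NExp)
  | mul (e f : NExp)
  | half (e : NExp)

def NExp.eval (s : State) : NExp → ℕ
  | .lit c => c
  | .reg x => s.nreg x
  | .add e f => e.eval s + f.eval s
  | .mul e f => e.eval s * f.eval s
  | .half e => e.eval s / 2

/-- The number of operations in an index expression. -/
def NExp.cost : NExp → ℕ
  | .lit _ => 0
  | .reg _ => 0
  | .add e f => e.cost + f.cost + 1
  | .mul e f => e.cost + f.cost + 1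
  | .half e => e.cost + 1

/-- Real expressions. -/
inductive RExp
  | ofN (e : NExp)
  | reg (x : RReg)
  | read (A : RArr) (e : NExp)
  | add (e f : RExp)
  | sub (e f : RExp)
  | mul (e f : RExp)
  | div (e f : RExp)

noncomputable def RExp.eval (s : State) : RExp → ℝ
  | .ofN e => (e.eval s : ℝ)
  | .reg x => s.rreg x
  | .read A e => s.rarr A (e.eval s)
  | .add e f => e.eval s + f.eval s
  | .sub e f => e.eval s - f.eval s
  | .mul e f => e.eval s * f.eval s
  | .div e f => e.eval s / f.eval s

/-- The number of operations (conversions, array reads, arithmetic) in a real expression. -/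
def RExp.cost : RExp → ℕ
  | .ofN e => e.cost + 1
  | .reg _ => 0
  | .read _ e => e.cost + 1
  | .add e f => e.cost + f.cost + 1
  | .sub e f => e.cost + f.cost + 1
  | .mul e f => e.cost + f.cost + 1
  | .div e f => e.cost + f.cost + 1

/-- Programs. `ifN e f c d` and `ifR e f c d` test `e < f` and run `c` or `d`;
`loop x e c` evaluates `e` once and runs `c` with `x = 0, 1, …, e - 1`;
`draw x` puts the next random number of the tape into `x`. -/
inductive Cmd
  | skip
  | seq (c d : Cmd)
  | setN (x : NReg) (e : NExp)
  | setR (x : RReg) (e : RExp)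
  | putN (A : NArr) (e : NExp) (f : NExp)
  | putR (A : RArr) (e : NExp) (f : RExp)
  | draw (x : RReg)
  | ifN (e f : NExp) (c d : Cmd)
  | ifR (e f : RExp) (c d : Cmd)
  | loop (x : NReg) (e : NExp) (c : Cmd)

/-- Execution of a program with the given tape of random numbers. -/
noncomputable def exec (tape : ℕ → ℝ) : Cmd → State → State
  | .skip, s => s
  | .seq c d, s => exec tape d (exec tape c s)
  | .setN x e, s =>
      { s with nreg := Function.update s.nreg x (e.eval s), time := s.time + e.cost + 1 }
  | .setR x e, s =>
      { s with rreg := Function.update s.rreg x (e.eval s), time := s.time + e.cost + 1 }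
  | .putN A e f, s =>
      { s with
        narr := Function.update s.narr A (Function.update (s.narr A) (e.eval s) (f.eval s))
        time := s.time + e.cost + f.cost + 1 }
  | .putR A e f, s =>
      { s with
        rarr := Function.update s.rarr A (Function.update (s.rarr A) (e.eval s) (f.eval s))
        time := s.time + e.cost + f.cost + 1 }
  | .draw x, s =>
      { s with
        rreg := Function.update s.rreg x (tape s.pos), pos := s.pos + 1, time := s.time + 1 }
  | .ifN e f c d, s =>
      if e.eval s < f.eval s
      then exec tape c { s with time := s.time + e.cost + f.cost + 1 }
      else exec tape d { s with time := s.time + e.cost + f.cost + 1 }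
  | .ifR e f c d, s =>
      if e.eval s < f.eval s
      then exec tape c { s with time := s.time + e.cost + f.cost + 1 }
      else exec tape d { s with time := s.time + e.cost + f.cost + 1 }
  | .loop x e c, s =>
      (List.range (e.eval s)).foldl
        (fun s' k => exec tape c
          { s' with nreg := Function.update s'.nreg x k, time := s'.time + 1 })
        { s with time := s.time + e.cost + 1 }

/-- Sequential composition of a list of programs. -/
def Cmd.block : List Cmd → Cmd
  | [] => .skip
  | c :: cs => .seq c (Cmd.block cs)

/-! ## The programs -/

/-- `row := (i * |A| + a) * |S|`, the offset of the row of `(i, a)` in the input arrays. -/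
def setRow : Cmd :=
  .setN .row (.mul (.add (.mul (.reg .i) (.reg .numA)) (.reg .a)) (.reg .numS))

/-- Preprocessing that builds the generative model. For each `(i, a)` it stores the partial sums
`cum[row + j] = ∑ l < j, P i a l`, and it computes the least `depth` with `|S| ≤ 2 ^ depth`. -/
def buildGM : Cmd :=
  .block [
    .loop .i (.reg .numS)
      (.loop .a (.reg .numA)
        (.block [
          setRow,
          .setR .acc (.ofN (.lit 0)),
          .loop .j (.reg .numS)
            (.block [
              .putR .cum (.add (.reg .row) (.reg .j)) (.reg .acc),
              .setR .acc (.add (.reg .acc) (.read .prob (.add (.reg .row) (.reg .j))))])])),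
    .setN .width (.lit 1),
    .setN .depth (.lit 0),
    .loop .j (.reg .numS)
      (.ifN (.reg .width) (.reg .numS)
        (.block [
          .setN .width (.add (.reg .width) (.reg .width)),
          .setN .depth (.add (.reg .depth) (.lit 1))])
        .skip)]

/-- One call `GM(i, a)`: it draws one uniform number, finds the next state by bisection in the
partial sums, and leaves that state in `lo` and the instant reward in `rew`. -/
def callGM : Cmd :=
  .block [
    setRow,
    .draw .u,
    .setN .lo (.lit 0),
    .setN .hi (.reg .numS),
    .loop .b (.reg .depth)
      (.block [
        .setN .mid (.half (.add (.reg .lo) (.reg .hi))),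
        .ifR (.reg .u) (.read .cum (.add (.reg .row) (.reg .mid)))
          (.setN .hi (.reg .mid))
          (.setN .lo (.reg .mid))]),
    .setR .rew (.read .reward (.add (.reg .row) (.reg .lo)))]

/-- Initialization of the shared vectors, `v ← 0` and `π ← 0`. -/
def initShared : Cmd :=
  .loop .i (.reg .numS)
    (.block [
      .putR .value (.reg .i) (.ofN (.lit 0)),
      .putN .policy (.reg .i) (.lit 0)])

/-- The body of one AsyncQVI iteration for the selected pair `(i, a)`: `K` calls of the generative
model, the value `q` (with the subtracted constant `(1 - γ) ε / 4`), and the conditional update of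
`v_i` and `π_i`. -/
def iteration : Cmd :=
  .block [
    .setR .sumR (.ofN (.lit 0)),
    .setR .sumV (.ofN (.lit 0)),
    .loop .k (.reg .numK)
      (.block [
        callGM,
        .setR .sumR (.add (.reg .sumR) (.reg .rew)),
        .setR .sumV (.add (.reg .sumV) (.read .view (.reg .lo)))]),
    .setR .q
      (.sub
        (.add (.div (.reg .sumR) (.ofN (.reg .numK)))
          (.mul (.reg .gamma) (.div (.reg .sumV) (.ofN (.reg .numK)))))
        (.div (.mul (.sub (.ofN (.lit 1)) (.reg .gamma)) (.reg .eps)) (.ofN (.lit 4)))),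
    .ifR (.read .value (.reg .i)) (.reg .q)
      (.block [
        .putR .value (.reg .i) (.reg .q),
        .putN .policy (.reg .i) (.reg .a)])
      .skip]

/-! ## Running AsyncQVI -/

/-- A three-dimensional table laid out in memory: entry `(i, a, j)` has address
`(i * m + a) * n + j`. -/
def flatten {n m : ℕ} (f : Fin n → Fin m → Fin n → ℝ) (x : ℕ) : ℝ :=
  if h : x / n / m < n ∧ x / n % m < m ∧ x % n < n then
    f ⟨x / n / m, h.1⟩ ⟨x / n % m, h.2.1⟩ ⟨x % n, h.2.2⟩
  else 0

theorem flatten_apply {n m : ℕ} (f : Fin n → Fin m → Fin n → ℝ) (i : Fin n) (a : Fin m)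
    (j : Fin n) : flatten f ((i * m + a) * n + j) = f i a j := by
  have hn : 0 < n := i.pos
  have hm : 0 < m := a.pos
  have h1 : ((i : ℕ) * m + a) * n + j = j + n * (i * m + a) := by ring
  have h2 : (((i : ℕ) * m + a) * n + j) / n = i * m + a := by
    rw [h1, Nat.add_mul_div_left _ _ hn, Nat.div_eq_of_lt j.isLt, zero_add]
  have h3 : (((i : ℕ) * m + a) * n + j) % n = j := by
    rw [h1, Nat.add_mul_mod_self_left, Nat.mod_eq_of_lt j.isLt]
  have h4 : ((i : ℕ) * m + a) = a + m * i := by ring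
  have h5 : ((i : ℕ) * m + a) / m = i := by
    rw [h4, Nat.add_mul_div_left _ _ hm, Nat.div_eq_of_lt a.isLt, zero_add]
  have h6 : ((i : ℕ) * m + a) % m = a := by
    rw [h4, Nat.add_mul_mod_self_left, Nat.mod_eq_of_lt a.isLt]
  simp [flatten, h2, h3, h5, h6]

/-- The initial memory: the full description of the DMDP, everything else `0`. -/
noncomputable def inputState {n m : ℕ} (M : DMDP n m) : State where
  nreg
    | .numS => n
    | .numA => m
    | _ => 0
  rreg
    | .gamma => M.γ
    | _ => 0
  rarr
    | .prob => flatten M.P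
    | .reward => flatten M.r
    | _ => fun _ => 0
  narr _ _ := 0
  pos := 0
  time := 0

/-- The memory after the preprocessing (which uses no random numbers). -/
noncomputable def builtState {n m : ℕ} (M : DMDP n m) : State :=
  exec (fun _ => 0) buildGM (inputState M)

/-- A state `s` with the pair `(i, a)` put into the registers `i`, `a` and a fresh tape. -/
def State.select (s : State) (i a : ℕ) : State :=
  { s with nreg := Function.update (Function.update s.nreg .i i) .a a, pos := 0 }

/-- The state after one call `GM(i, a)` to the generative model that was built, when the random
number drawn is `u`. -/
noncomputable def callState {n m : ℕ} (M : DMDP n m) (i : Fin n) (a : Fin m) (u : ℝ) : State :=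
  exec (fun _ => u) callGM ((builtState M).select i a)

/-- One asynchronous schedule: the pair `(i_t, a_t)` selected in iteration `t`, and the iteration
number `readTime t j = τ_j(t)` of the version of `v_j` that is used in iteration `t`. -/
structure Schedule (n m : ℕ) where
  state : ℕ → Fin n
  action : ℕ → Fin m
  readTime : ℕ → Fin n → ℕ

/-- Partial asynchronism: (a) every coordinate `(i, a)` is selected at least once in any `B₁`
consecutive iterations; (b) `t - B₂ < τ_j(t) ≤ t`. -/
def Schedule.PartiallyAsync {n m : ℕ} (σ : Schedule n m) (B₁ B₂ : ℕ) : Prop :=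
  (∀ i a t, ∃ s, t ≤ s ∧ s < t + B₁ ∧ σ.state s = i ∧ σ.action s = a) ∧
  (∀ j t, t < σ.readTime t j + B₂ ∧ σ.readTime t j ≤ t)

/-- The machine states at the start of iterations `0, …, t`. Iteration `t` works on the current
shared vectors, sees `v̂_j = v_j(τ_j(t))`, and draws its random numbers from `U t`. The four extra
time units pay for the two selected indices, the test `t < L` and the increment of `t`. -/
noncomputable def history {n m : ℕ} (s₀ : State) (σ : Schedule n m) (U : ℕ → ℕ → ℝ) :
    ℕ → ℕ → State
  | 0 => fun _ => s₀
  | t + 1 =>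
      let H := history s₀ σ U t
      let s := (H t).select (σ.state t) (σ.action t)
      let vhat : ℕ → ℝ :=
        fun j => if h : j < n then (H (σ.readTime t ⟨j, h⟩)).rarr .value j else 0
      Function.update H (t + 1)
        (exec (U t) iteration
          { s with rarr := Function.update s.rarr .view vhat, time := s.time + 4 })

/-- The final state of AsyncQVI on a fully known DMDP: preprocessing, loading the parameters `K` and
`ε`, initialization, then `L` asynchronous iterations. Its `time` is the total number of elementary
steps, made by all agents together and including the preprocessing. -/
noncomputable def run {n m : ℕ} (M : DMDP n m) (ε : ℝ) (L K : ℕ) (σ : Schedule n m)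
    (U : ℕ → ℕ → ℝ) : State :=
  let s := builtState M
  let s₁ : State :=
    { s with
      nreg := Function.update s.nreg .numK K
      rreg := Function.update s.rreg .eps ε
      time := s.time + 2 }
  history (exec (fun _ => 0) initShared s₁) σ U L L

/-- The vector `π` held in memory is an `ε`-optimal policy. -/
def State.HoldsEpsOptimal {n m : ℕ} (s : State) (M : DMDP n m) (ε : ℝ) : Prop :=
  ∃ π : Fin n → Fin m, (∀ i : Fin n, s.narr .policy i = π i) ∧ M.IsEpsOptimal ε π

/-- The number of iterations. -/
noncomputable def iterationNumber (γ ε : ℝ) (B₁ B₂ : ℕ) : ℕ :=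
  ⌈2 * (B₁ : ℝ) + ((B₁ : ℝ) + B₂ - 1) / (1 - γ) * Real.log (2 / ((1 - γ) * ε))⌉₊

/-- The number of samples per iteration. -/
noncomputable def sampleNumber (γ ε δ : ℝ) (L : ℕ) : ℕ :=
  ⌈8 / ((1 - γ) ^ 4 * ε ^ 2) * Real.log (4 * L / δ)⌉₊

/-- The randomness of a run. `U t k` are the uniform random numbers available in iteration `t`, and
`ℱ t` is the information available before they are drawn: they are i.i.d. and independent of `ℱ t`,
and the selected pair and the read times of iteration `t` are determined by `ℱ t` (so they may be
random and may depend on the past, but not on the samples of iteration `t` or later). -/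
structure IsRandomRun {n m : ℕ} {Ω : Type*} [mΩ : MeasurableSpace Ω] (μ : Measure Ω)
    (ℱ : Filtration ℕ mΩ) (σ : Ω → Schedule n m) (U : ℕ → ℕ → Ω → ℝ) : Prop where
  uniform : ∀ t k, pdf.IsUniform (U t k) (Set.Icc 0 1) μ volume
  iIndep : ∀ t, iIndepFun (U t) μ
  fresh : ∀ t, Indep (⨆ k, MeasurableSpace.comap (U t k) inferInstance) (ℱ t) μ
  adapted : ∀ t k, Measurable[ℱ (t + 1)] (U t k)
  state : ∀ t, Measurable[ℱ t] fun ω => (σ ω).state t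
  action : ∀ t, Measurable[ℱ t] fun ω => (σ ω).action t
  readTime : ∀ t j, Measurable[ℱ t] fun ω => (σ ω).readTime t j

/-- The bound `f · (log f)^p` behind the notation `Õ(f)`; the logarithm is taken at `2 + f` so that
it is bounded away from `0`. -/
noncomputable def softO (p : ℕ) (f : ℝ) : ℝ := f * Real.log (2 + f) ^ p

end AsyncQVI

open AsyncQVI

/-! The proof splits into a deterministic, a probabilistic and a computational argument.
Deterministic: suppose every empirical backup is off by at most `(1 - γ) ε / 4`. After subtraction
of that same amount, each `q` lies below the true backup of the vector read, by at most `η = (1 - γ)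
ε / 2`. The shared vector only increases, so a stale read is a lower bound for the current vector.
Hence `v ≤ T^π v` is an invariant (`le_backup_policy`), and the contraction property turns it into
`v ≤ v^π`. In the other direction, every stretch of `B₁ + B₂ - 1` iterations replaces a bound `d` on
`v* - v` by `γ d + η` (`optimalValue_sub_le_geometric`). The limit `η / (1 - γ)` is `ε / 2`, and `L`
is large enough for the transient to be at most `ε / 2` too. So `v* - ε ≤ v ≤ v^π ≤ v*`.
Probabilistic: the selected pair and the vector read in iteration `t` are determined by `ℱ t`, hence
independent of the numbers `U t`. With these inputs frozen, the `K` samples are i.i.d. with values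
in `[0, 1 / (1 - γ)]`, and Hoeffding's inequality applies (`measure_sampleError_le`). The choice of
`K` makes the union bound over `L` iterations at most `δ`. Computational: loop invariants that carry
the elapsed time show that the programs compute these quantities and what they cost. Bisection in
the partial sums finds the next state in `Nat.clog 2 n` rounds. The total is `O(n² m)` plus `L`
times `O(K log n)`. Up to logarithms `L` is `n m / (1 - γ)` and `K` is `log (2 / δ) / ((1 - γ)⁴
ε²)`, and the product is the claimed bound. -/

namespace AsyncQVI

section

/-! ## The value vector and the Bellman equation -/

namespace DMDP

variable {n m : ℕ}

/-- The action of the transition matrix of `π` on vectors. -/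
def transition (M : DMDP n m) (π : Fin n → Fin m) (g : Fin n → ℝ) (i : Fin n) : ℝ :=
  ∑ j, M.P i (π i) j * g j

/-- The expected reward plus discounted expected value of `g` when `a` is taken in `i`. -/
def backup (M : DMDP n m) (g : Fin n → ℝ) (i : Fin n) (a : Fin m) : ℝ :=
  ∑ j, M.P i a j * (M.r i a j + M.γ * g j)

theorem sum_P_mul_le (M : DMDP n m) (i : Fin n) (a : Fin m) {g : Fin n → ℝ} {c : ℝ}
    (h : ∀ j, g j ≤ c) : ∑ j, M.P i a j * g j ≤ c := by
  calc ∑ j, M.P i a j * g j ≤ ∑ j, M.P i a j * c :=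
        Finset.sum_le_sum fun j _ => mul_le_mul_of_nonneg_left (h j) (M.P_nonneg i a j)
    _ = c := by rw [← Finset.sum_mul, M.P_sum, one_mul]

theorem le_sum_P_mul (M : DMDP n m) (i : Fin n) (a : Fin m) {g : Fin n → ℝ} {c : ℝ}
    (h : ∀ j, c ≤ g j) : c ≤ ∑ j, M.P i a j * g j := by
  calc c = ∑ j, M.P i a j * c := by rw [← Finset.sum_mul, M.P_sum, one_mul]
    _ ≤ ∑ j, M.P i a j * g j :=
        Finset.sum_le_sum fun j _ => mul_le_mul_of_nonneg_left (h j) (M.P_nonneg i a j)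

theorem backup_mono (M : DMDP n m) {g h : Fin n → ℝ} (hgh : ∀ j, g j ≤ h j) (i : Fin n)
    (a : Fin m) : M.backup g i a ≤ M.backup h i a := by
  refine Finset.sum_le_sum fun j _ => mul_le_mul_of_nonneg_left ?_ (M.P_nonneg i a j)
  have := mul_le_mul_of_nonneg_left (hgh j) M.γ_pos.le
  linarith

/-- One-sided form of the `γ`-contraction: an upper bound on `g - h` suffices, which fits the
one-sided estimates below. -/
theorem backup_sub_le (M : DMDP n m) {g h : Fin n → ℝ} {c : ℝ} (hgh : ∀ j, g j - h j ≤ c)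
    (i : Fin n) (a : Fin m) : M.backup g i a - M.backup h i a ≤ M.γ * c := by
  have e : M.backup g i a - M.backup h i a = ∑ j, M.P i a j * (M.γ * (g j - h j)) := by
    rw [backup, backup, ← Finset.sum_sub_distrib]
    exact Finset.sum_congr rfl fun j _ => by ring
  rw [e]
  exact M.sum_P_mul_le i a fun j => mul_le_mul_of_nonneg_left (hgh j) M.γ_pos.le

theorem integral_stepKernel (M : DMDP n m) (π : Fin n → Fin m) (i : Fin n) (g : Fin n → ℝ) :
    ∫ j, g j ∂(M.stepKernel π i) = M.transition π g i := by
  change ∫ j, g j ∂(∑ j, ENNReal.ofReal (M.P i (π i) j) • Measure.dirac j : Measure (Fin n)) = _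
  have hfin (j : Fin n) : IsFiniteMeasure (ENNReal.ofReal (M.P i (π i) j) • Measure.dirac j) :=
    Measure.smul_finite _ ENNReal.ofReal_ne_top
  rw [integral_finsetSum_measure fun j _ => .of_finite]
  refine Finset.sum_congr rfl fun j _ => ?_
  rw [integral_smul_measure, integral_dirac, ENNReal.toReal_ofReal (M.P_nonneg _ _ _), smul_eq_mul]

instance (M : DMDP n m) (π : Fin n → Fin m) (i : Fin n) :
    IsProbabilityMeasure (M.trajectoryLaw π i) := by
  unfold trajectoryLaw; infer_instance

theorem measurable_eval_pair (f : Fin n → Fin n → ℝ) (s t : ℕ) :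
    Measurable fun x : ℕ → Fin n => f (x s) (x t) := by
  have h : Measurable (Function.uncurry f) := measurable_of_finite _
  have h' : Measurable fun x : ℕ → Fin n => (x s, x t) := by fun_prop
  exact h.comp h'

/-- Markov property: the history up to `t` together with the next state has law `partialTraj ⊗ κ t`,
so the next state can be integrated out first, with the history fixed. -/
theorem integral_trajectoryLaw_succ (M : DMDP n m) (π : Fin n → Fin m) (i : Fin n) (t : ℕ)
    (f : Fin n → Fin n → ℝ) :
    ∫ s, f (s t) (s (t + 1)) ∂(M.trajectoryLaw π i) =
      ∫ s, M.transition π (f (s t)) (s t) ∂(M.trajectoryLaw π i) := by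
  let κ : (t : ℕ) → Kernel ((k : Finset.Iic t) → (fun _ => Fin n) (k : ℕ)) (Fin n) :=
    fun t => (M.stepKernel π).comap (fun h => h ⟨t, Finset.mem_Iic.2 le_rfl⟩)
      (measurable_pi_apply _)
  have hκ := Kernel.partialTraj_compProd_eq_map_traj (X := fun _ => Fin n) (κ := κ)
    (Nat.zero_le t) (x₀ := fun _ => i)
  have hm : Measurable fun p : ((k : Finset.Iic t) → Fin n) × Fin n =>
      f (p.1 ⟨t, Finset.mem_Iic.2 le_rfl⟩) p.2 := by
    have h : Measurable (Function.uncurry f) := measurable_of_finite _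
    have h' : Measurable fun p : ((k : Finset.Iic t) → Fin n) × Fin n =>
      (p.1 ⟨t, Finset.mem_Iic.2 le_rfl⟩, p.2) := by fun_prop
    exact h.comp h'
  have h1 : ∫ s, f (s t) (s (t + 1)) ∂(M.trajectoryLaw π i) =
      ∫ p, f (p.1 ⟨t, Finset.mem_Iic.2 le_rfl⟩) p.2
        ∂((Kernel.partialTraj (X := fun _ => Fin n) κ 0 t (fun _ => i)) ⊗ₘ (κ t)) := by
    rw [hκ, integral_map (by fun_prop) hm.aestronglyMeasurable]
    rfl
  rw [h1, Measure.integral_compProd, ← Kernel.traj_map_frestrictLe_apply, integral_map]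
  · refine integral_congr_ae (.of_forall fun s => ?_)
    exact M.integral_stepKernel π (s t) (f (s t))
  · fun_prop
  · exact (measurable_of_finite _).aestronglyMeasurable
  · exact .of_finite

theorem integral_trajectoryLaw (M : DMDP n m) (π : Fin n → Fin m) (i : Fin n) (t : ℕ) :
    ∀ g : Fin n → ℝ, ∫ s, g (s t) ∂(M.trajectoryLaw π i) = (M.transition π)^[t] g i := by
  induction t with
  | zero =>
    intro g
    have h := Kernel.traj_map_frestrictLe_apply (X := fun _ => Fin n)
      (κ := fun t => (M.stepKernel π).comap (fun h => h ⟨t, Finset.mem_Iic.2 le_rfl⟩)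
      (measurable_pi_apply _)) 0 0 (fun _ => i)
    have h2 : ∫ s, g (s 0) ∂(M.trajectoryLaw π i) = ∫ x, g (x ⟨0, Finset.mem_Iic.2 le_rfl⟩)
        ∂((M.trajectoryLaw π i).map (Preorder.frestrictLe (π := fun _ => Fin n) 0)) := by
      rw [integral_map (by fun_prop) (measurable_of_finite _).aestronglyMeasurable]
      rfl
    rw [h2, trajectoryLaw, h, Kernel.partialTraj_self, Kernel.id_apply, integral_dirac]
    rfl
  | succ t ih =>
    intro g
    rw [M.integral_trajectoryLaw_succ π i t fun _ j => g j, Function.iterate_succ_apply]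
    exact ih (M.transition π g)

/-- The expected one-step reward under `π`. -/
def meanReward (M : DMDP n m) (π : Fin n → Fin m) (i : Fin n) : ℝ :=
  M.transition π (M.r i (π i)) i

theorem transition_iterate_meanReward_mem (M : DMDP n m) (π : Fin n → Fin m) (t : ℕ) :
    ∀ i, (M.transition π)^[t] (M.meanReward π) i ∈ Set.Icc (0 : ℝ) 1 := by
  induction t with
  | zero =>
    exact fun i => ⟨M.le_sum_P_mul _ _ fun j => (M.r_mem _ _ j).1,
      M.sum_P_mul_le _ _ fun j => (M.r_mem _ _ j).2⟩
  | succ t ih =>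
    intro i
    rw [Function.iterate_succ_apply']
    exact ⟨M.le_sum_P_mul _ _ fun j => (ih j).1, M.sum_P_mul_le _ _ fun j => (ih j).2⟩

theorem summable_discounted (M : DMDP n m) {f : ℕ → ℝ} (hf : ∀ t, f t ∈ Set.Icc (0 : ℝ) 1) :
    Summable fun t => M.γ ^ t * f t :=
  Summable.of_nonneg_of_le (fun t => mul_nonneg (pow_nonneg M.γ_pos.le t) (hf t).1)
    (fun t => mul_le_of_le_one_right (pow_nonneg M.γ_pos.le t) (hf t).2)
    (summable_geometric_of_lt_one M.γ_pos.le M.γ_lt_one)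

/-- Expectation and series may be exchanged because the `t`-th term is dominated by `γ ^ t`. -/
theorem value_eq_tsum (M : DMDP n m) (π : Fin n → Fin m) (i : Fin n) :
    M.value π i = ∑' t : ℕ, M.γ ^ t * (M.transition π)^[t] (M.meanReward π) i := by
  have hmeas (t : ℕ) : Measurable fun s : ℕ → Fin n =>
      M.γ ^ t * M.r (s t) (π (s t)) (s (t + 1)) :=
    (measurable_eval_pair (fun x y => M.r x (π x) y) t (t + 1)).const_mul _
  have hb (t : ℕ) (s : ℕ → Fin n) : ‖M.γ ^ t * M.r (s t) (π (s t)) (s (t + 1))‖ ≤ M.γ ^ t := by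
    rw [Real.norm_of_nonneg (mul_nonneg (pow_nonneg M.γ_pos.le t) (M.r_mem _ _ _).1)]
    exact mul_le_of_le_one_right (pow_nonneg M.γ_pos.le t) (M.r_mem _ _ _).2
  have hint (t : ℕ) : Integrable (fun s : ℕ → Fin n =>
      M.γ ^ t * M.r (s t) (π (s t)) (s (t + 1))) (M.trajectoryLaw π i) :=
    .of_bound (hmeas t).aestronglyMeasurable _ (.of_forall (hb t))
  rw [value, ← integral_tsum_of_summable_integral_norm hint]
  · refine tsum_congr fun t => ?_
    rw [integral_const_mul, M.integral_trajectoryLaw_succ π i t fun x y => M.r x (π x) y]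
    congr 1
    exact M.integral_trajectoryLaw π i t (M.meanReward π)
  · refine Summable.of_nonneg_of_le (fun t => integral_nonneg fun s => norm_nonneg _) (fun t => ?_)
      (summable_geometric_of_lt_one M.γ_pos.le M.γ_lt_one)
    refine (integral_mono (hint t).norm (integrable_const (M.γ ^ t)) (hb t)).trans_eq ?_
    simp

theorem value_bellman (M : DMDP n m) (π : Fin n → Fin m) (i : Fin n) :
    M.value π i = M.backup (M.value π) i (π i) := by
  have hs (j : Fin n) := M.summable_discounted
    (f := fun t => (M.transition π)^[t] (M.meanReward π) j)
    fun t => M.transition_iterate_meanReward_mem π t j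
  rw [value_eq_tsum, (hs i).tsum_eq_zero_add]
  have e (t : ℕ) : M.γ ^ (t + 1) * (M.transition π)^[t + 1] (M.meanReward π) i =
      ∑ j, M.P i (π i) j * M.γ * (M.γ ^ t * (M.transition π)^[t] (M.meanReward π) j) := by
    rw [Function.iterate_succ_apply', transition, Finset.mul_sum]
    exact Finset.sum_congr rfl fun j _ => by ring
  simp_rw [e]
  rw [Summable.tsum_finsetSum fun j _ => (hs j).mul_left _]
  simp_rw [tsum_mul_left, ← value_eq_tsum]
  simp only [backup, meanReward, transition, Function.iterate_zero, id, pow_zero, one_mul,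
    ← Finset.sum_add_distrib]
  exact Finset.sum_congr rfl fun j _ => by ring

theorem value_mem (M : DMDP n m) (π : Fin n → Fin m) (i : Fin n) :
    M.value π i ∈ Set.Icc 0 (1 - M.γ)⁻¹ := by
  have h (t : ℕ) := M.transition_iterate_meanReward_mem π t i
  rw [value_eq_tsum]
  refine ⟨tsum_nonneg fun t => mul_nonneg (pow_nonneg M.γ_pos.le t) (h t).1, ?_⟩
  rw [← tsum_geometric_of_lt_one M.γ_pos.le M.γ_lt_one]
  exact (M.summable_discounted h).tsum_le_tsum
    (fun t => mul_le_of_le_one_right (pow_nonneg M.γ_pos.le t) (h t).2)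
    (summable_geometric_of_lt_one M.γ_pos.le M.γ_lt_one)

/-- A vector below its one-step backup under `π` is below the value of `π`. -/
theorem le_value_of_le_backup (M : DMDP n m) (π : Fin n → Fin m) {v : Fin n → ℝ}
    (h : ∀ i, v i ≤ M.backup v i (π i)) (i : Fin n) : v i ≤ M.value π i := by
  -- At a state `k` where the excess `d = v k - v^π k` is largest, hypothesis and contraction give
  -- `d ≤ γ d`, hence `d ≤ 0`.
  obtain ⟨k, -, hk⟩ := Finset.univ.exists_max_image (fun i => v i - M.value π i)
    ⟨i, Finset.mem_univ i⟩
  have h1 := M.backup_sub_le (fun j => hk j (Finset.mem_univ j)) k (π k)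
  have h2 := h k
  have h3 := M.value_bellman π k
  have h4 := hk i (Finset.mem_univ i)
  have h5 := M.γ_lt_one
  have h6 : v k - M.value π k ≤ 0 := by
    by_contra hc
    push Not at hc
    nlinarith
  linarith

theorem value_le_optimalValue (M : DMDP n m) (π : Fin n → Fin m) (i : Fin n) :
    M.value π i ≤ M.optimalValue i :=
  le_ciSup (f := fun π => M.value π i) (Set.finite_range _).bddAbove π

/-- The maximizing policy may depend on `i`: its Bellman equation at `i` and monotonicity already
give this half of the optimality equation. No policy that is optimal in all states at once is
needed. -/
theorem exists_optimalValue_le_backup (M : DMDP n m) (hm : 0 < m) (i : Fin n) :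
    ∃ a, M.optimalValue i ≤ M.backup M.optimalValue i a := by
  have : Nonempty (Fin n → Fin m) := ⟨fun _ => ⟨0, hm⟩⟩
  obtain ⟨π, hπ⟩ := exists_eq_ciSup_of_finite (f := fun π => M.value π i)
  refine ⟨π i, ?_⟩
  calc M.optimalValue i = M.value π i := hπ.symm
    _ = M.backup (M.value π) i (π i) := M.value_bellman π i
    _ ≤ _ := M.backup_mono (M.value_le_optimalValue π) i (π i)

theorem optimalValue_mem (M : DMDP n m) (hm : 0 < m) (i : Fin n) :
    M.optimalValue i ∈ Set.Icc 0 (1 - M.γ)⁻¹ := by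
  have : Nonempty (Fin n → Fin m) := ⟨fun _ => ⟨0, hm⟩⟩
  obtain ⟨π, hπ⟩ := exists_eq_ciSup_of_finite (f := fun π => M.value π i)
  rw [optimalValue, ← hπ]
  exact M.value_mem π i

theorem isEpsOptimal_of_le_value (M : DMDP n m) {ε : ℝ} (hε : 0 ≤ ε) {π : Fin n → Fin m}
    (h : ∀ i, M.optimalValue i - ε ≤ M.value π i) : M.IsEpsOptimal ε π := by
  refine (pi_norm_le_iff_of_nonneg hε).2 fun i => ?_
  rw [Pi.sub_apply, Real.norm_of_nonneg (sub_nonneg.2 (M.value_le_optimalValue π i))]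
  linarith [h i]

end DMDP

end

section

/-! ## Convergence of asynchronous value iteration with inexact backups -/

variable {n m : ℕ}

/-- The vectors `v t` and the policies `π t` for `t ≤ L` arise by conditional updates at the selected
coordinates with the numbers `q t`, each of which underestimates a backup of the vector that is read
by at most `η`. -/
structure IsInexactIteration (M : DMDP n m) (σ : Schedule n m) (L : ℕ) (η : ℝ)
    (v : ℕ → Fin n → ℝ) (π : ℕ → Fin n → Fin m) (q : ℕ → ℝ) : Prop where
  zero : ∀ j, v 0 j = 0
  value_succ : ∀ t < L, ∀ j,
    v (t + 1) j = if j = σ.state t ∧ v t j < q t then q t else v t j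
  policy_succ : ∀ t < L, ∀ j,
    π (t + 1) j = if j = σ.state t ∧ v t j < q t then σ.action t else π t j
  le_backup : ∀ t < L,
    q t ≤ M.backup (fun j => v (σ.readTime t j) j) (σ.state t) (σ.action t)
  backup_le : ∀ t < L,
    M.backup (fun j => v (σ.readTime t j) j) (σ.state t) (σ.action t) ≤ q t + η

namespace IsInexactIteration

variable {M : DMDP n m} {σ : Schedule n m} {L : ℕ} {η : ℝ} {v : ℕ → Fin n → ℝ}
  {π : ℕ → Fin n → Fin m} {q : ℕ → ℝ}

theorem mono (h : IsInexactIteration M σ L η v π q) {s t : ℕ} (hst : s ≤ t) (ht : t ≤ L)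
    (j : Fin n) : v s j ≤ v t j := by
  induction t, hst using Nat.le_induction with
  | base => exact le_rfl
  | succ t _ ih =>
    refine (ih (by omega)).trans ?_
    rw [h.value_succ t ht]
    split_ifs with hc
    · exact hc.2.le
    · exact le_rfl

/-- Initially the vector is `0` and rewards are nonnegative, so any policy will do. A fresh entry is
at most a backup of a stale vector, which lies below the new one. An old entry keeps its action, and
its backup can only grow. -/
theorem le_backup_policy (h : IsInexactIteration M σ L η v π q) {B₁ B₂ : ℕ}
    (hσ : σ.PartiallyAsync B₁ B₂) {t : ℕ} (ht : t ≤ L) :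
    ∀ i, v t i ≤ M.backup (v t) i (π t i) := by
  induction t with
  | zero =>
    intro i
    rw [h.zero]
    refine M.le_sum_P_mul _ _ fun j => ?_
    rw [h.zero, mul_zero, add_zero]
    exact (M.r_mem _ _ j).1
  | succ t ih =>
    intro i
    have hm := M.backup_mono (h.mono (Nat.le_succ t) ht)
    rw [h.value_succ t ht, h.policy_succ t ht]
    split_ifs with hc
    · obtain ⟨rfl, -⟩ := hc
      refine (h.le_backup t ht).trans (le_trans ?_ (hm _ _))
      exact M.backup_mono (fun j => h.mono (hσ.2 j t).2 (by omega) j) _ _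
    · exact (ih (by omega) i).trans (hm _ _)

/-- An action that is good for `v*` in `i` is tried at some time `s` of the window. The number `q s`
is then within `γ d + η` of the optimum, and `v i` never falls afterwards. -/
theorem optimalValue_sub_le (h : IsInexactIteration M σ L η v π q) (hm : 0 < m) {B₁ B₂ : ℕ}
    (hσ : σ.PartiallyAsync B₁ B₂) {t : ℕ} (ht : t + B₁ ≤ L) {d : ℝ}
    (hd : ∀ s, t ≤ s → s < t + B₁ → ∀ j, M.optimalValue j - v (σ.readTime s j) j ≤ d) (i : Fin n) :
    M.optimalValue i - v (t + B₁) i ≤ M.γ * d + η := by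
  obtain ⟨a, ha⟩ := M.exists_optimalValue_le_backup hm i
  obtain ⟨s, hts, hs, rfl, rfl⟩ := hσ.1 i a t
  have h1 := M.backup_sub_le (hd s hts hs) (σ.state s) (σ.action s)
  have h2 := h.backup_le s (by omega)
  have h3 : q s ≤ v (s + 1) (σ.state s) := by
    rw [h.value_succ s (by omega)]
    split_ifs with hc
    · exact le_rfl
    · exact not_lt.1 fun hlt => hc ⟨rfl, hlt⟩
  have h4 := h.mono (show s + 1 ≤ t + B₁ by omega) ht (σ.state s)
  linarith

/-- A further block consists of `B₂ - 1` iterations, after which every read postdates the previous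
checkpoint, and of `B₁` more, in which every pair is selected. The first block needs only `B₁`,
since the initial gap `(1 - γ)⁻¹` bounds every read. -/
theorem optimalValue_sub_le_geometric (h : IsInexactIteration M σ L η v π q) (hm : 0 < m)
    {B₁ B₂ : ℕ} (hB₂ : 0 < B₂) (hσ : σ.PartiallyAsync B₁ B₂) (k : ℕ)
    (hk : B₁ + k * (B₁ + B₂ - 1) ≤ L) (hη : 0 ≤ η) (i : Fin n) :
    M.optimalValue i - v (B₁ + k * (B₁ + B₂ - 1)) i ≤
      M.γ ^ (k + 1) * (1 - M.γ)⁻¹ + η * (1 - M.γ)⁻¹ := by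
  have hγ : 0 < 1 - M.γ := sub_pos.2 M.γ_lt_one
  -- `η / (1 - γ)` is the fixed point of `d ↦ γ d + η`.
  have e : M.γ * (η * (1 - M.γ)⁻¹) + η = η * (1 - M.γ)⁻¹ := by field_simp; ring
  induction k generalizing i with
  | zero =>
    simp only [zero_mul, add_zero] at hk ⊢
    have hd := h.optimalValue_sub_le hm hσ (t := 0) (d := (1 - M.γ)⁻¹) (by omega)
      (fun s _ hs j => by
        have h1 := h.mono (Nat.zero_le (σ.readTime s j)) (by have := (hσ.2 j s).2; omega) j
        rw [h.zero] at h1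
        linarith [(M.optimalValue_mem hm j).2]) i
    rw [zero_add] at hd
    have h2 : 0 ≤ M.γ * (η * (1 - M.γ)⁻¹) :=
      mul_nonneg M.γ_pos.le (mul_nonneg hη (inv_nonneg.2 hγ.le))
    linarith [pow_one M.γ]
  | succ k ih =>
    have e1 : B₁ + (k + 1) * (B₁ + B₂ - 1) = B₁ + k * (B₁ + B₂ - 1) + (B₂ - 1) + B₁ := by
      rw [add_mul]; omega
    rw [e1] at hk ⊢
    refine (h.optimalValue_sub_le hm hσ hk
      (d := M.γ ^ (k + 1) * (1 - M.γ)⁻¹ + η * (1 - M.γ)⁻¹) (fun s hs hs' j => ?_) i).trans_eq ?_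
    · have hr := hσ.2 j s
      have h1 := h.mono (show B₁ + k * (B₁ + B₂ - 1) ≤ σ.readTime s j by omega) (by omega) j
      linarith [ih (by omega) j]
    · rw [mul_add, add_assoc, e]; ring

theorem isEpsOptimal {ε : ℝ} {B₁ B₂ : ℕ}
    (h : IsInexactIteration M σ (iterationNumber M.γ ε B₁ B₂) ((1 - M.γ) * ε / 2) v π q)
    (hm : 0 < m) (hε : 0 < ε) (hε' : ε < (1 - M.γ)⁻¹) (hB₁ : 0 < B₁) (hB₂ : 0 < B₂)
    (hσ : σ.PartiallyAsync B₁ B₂) :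
    M.IsEpsOptimal ε (π (iterationNumber M.γ ε B₁ B₂)) := by
  have hγ : 0 < 1 - M.γ := sub_pos.2 M.γ_lt_one
  have hεγ : (1 - M.γ) * ε < 1 := by
    rwa [lt_inv_comm₀ hε hγ, ← one_div, lt_div_iff₀ hε] at hε'
  set x := Real.log (2 / ((1 - M.γ) * ε)) / (1 - M.γ) with hx
  have hlog : 0 < Real.log (2 / ((1 - M.γ) * ε)) :=
    Real.log_pos (by rw [lt_div_iff₀ (by positivity)]; linarith)
  have hx0 : 0 < x := div_pos hlog hγ
  -- The first block already contracts once, so `k = ⌈x⌉ - 1` further blocks give the exponent `k +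
  -- 1 ≥ x`, while `k ≤ x` lets them fit into `L`.
  obtain ⟨k, hk⟩ : ∃ k, ⌈x⌉₊ = k + 1 := ⟨⌈x⌉₊ - 1, by have := Nat.ceil_pos.2 hx0; omega⟩
  have hkx : (k : ℝ) ≤ x := by
    have := Nat.ceil_lt_add_one hx0.le
    rw [hk] at this
    push_cast at this
    linarith
  have hxk : x ≤ k + 1 := by
    have := Nat.le_ceil x
    rw [hk] at this
    exact_mod_cast this
  have hL : B₁ + k * (B₁ + B₂ - 1) ≤ iterationNumber M.γ ε B₁ B₂ := by
    have hB : ((B₁ + B₂ - 1 : ℕ) : ℝ) = B₁ + B₂ - 1 := by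
      rw [Nat.cast_sub (by omega)]; push_cast; ring
    have h1 : (1 : ℝ) ≤ B₁ := by exact_mod_cast hB₁
    have h2 : (1 : ℝ) ≤ B₂ := by exact_mod_cast hB₂
    rw [iterationNumber, ← Nat.cast_le (α := ℝ)]
    refine le_trans ?_ (Nat.le_ceil _)
    push_cast
    rw [hB, div_mul_eq_mul_div, mul_div_assoc, ← hx, mul_comm (k : ℝ)]
    have := mul_le_mul_of_nonneg_left hkx (show (0 : ℝ) ≤ B₁ + B₂ - 1 by linarith)
    linarith
  have hpow : M.γ ^ (k + 1) ≤ (1 - M.γ) * ε / 2 := by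
    have h1 : M.γ ≤ Real.exp (-(1 - M.γ)) := by
      have := Real.add_one_le_exp (-(1 - M.γ))
      linarith
    calc M.γ ^ (k + 1) ≤ Real.exp (-(1 - M.γ)) ^ (k + 1) :=
          pow_le_pow_left₀ M.γ_pos.le h1 _
      _ = Real.exp (-((k + 1) * (1 - M.γ))) := by
          rw [← Real.exp_nat_mul]; push_cast; ring_nf
      _ ≤ Real.exp (-Real.log (2 / ((1 - M.γ) * ε))) := by
          rw [hx, div_le_iff₀ hγ] at hxk
          exact Real.exp_le_exp.2 (neg_le_neg hxk)
      _ = (1 - M.γ) * ε / 2 := by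
          rw [Real.exp_neg, Real.exp_log (by positivity), inv_div]
  refine M.isEpsOptimal_of_le_value hε.le fun i => ?_
  have h1 := h.optimalValue_sub_le_geometric hm hB₂ hσ k hL (by positivity) i
  have h2 := h.mono hL le_rfl i
  have h3 := M.le_value_of_le_backup _ (h.le_backup_policy hσ le_rfl) i
  have h4 : M.γ ^ (k + 1) * (1 - M.γ)⁻¹ ≤ (1 - M.γ) * ε / 2 * (1 - M.γ)⁻¹ :=
    mul_le_mul_of_nonneg_right hpow (inv_nonneg.2 hγ.le)
  have h5 : (1 - M.γ) * ε / 2 * (1 - M.γ)⁻¹ = ε / 2 := by field_simp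
  linarith

end IsInexactIteration

end

section

/-! ## Bisection in the partial sums of a row -/

variable {n m : ℕ}

/-- The partial sums of the row of `(i, a)`. -/
def DMDP.cum (M : DMDP n m) (i : Fin n) (a : Fin m) (j : ℕ) : ℝ :=
  ∑ l : Fin n with l.1 < j, M.P i a l

namespace DMDP

theorem cum_zero (M : DMDP n m) (i : Fin n) (a : Fin m) : M.cum i a 0 = 0 := by
  simp [cum]

theorem cum_succ (M : DMDP n m) (i : Fin n) (a : Fin m) (j : Fin n) :
    M.cum i a (j + 1) = M.cum i a j + M.P i a j := by
  have : (Finset.univ.filter fun l : Fin n => l.1 < j.1 + 1) =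
      insert j (Finset.univ.filter fun l : Fin n => l.1 < j.1) := by
    ext l
    simp only [Finset.mem_filter, Finset.mem_univ, true_and, Finset.mem_insert, Fin.ext_iff]
    omega
  rw [cum, this, Finset.sum_insert (by simp), add_comm]
  rfl

theorem cum_card (M : DMDP n m) (i : Fin n) (a : Fin m) : M.cum i a n = 1 := by
  rw [cum, Finset.filter_true_of_mem fun l _ => l.isLt, M.P_sum]

theorem cum_mono (M : DMDP n m) (i : Fin n) (a : Fin m) : Monotone (M.cum i a) := fun j k hjk =>
  Finset.sum_le_sum_of_subset_of_nonneg
    (fun l hl => by simp only [Finset.mem_filter] at hl ⊢; exact ⟨hl.1, hl.2.trans_le hjk⟩)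
    fun l _ _ => M.P_nonneg i a l

theorem cum_nonneg (M : DMDP n m) (i : Fin n) (a : Fin m) (j : ℕ) : 0 ≤ M.cum i a j :=
  Finset.sum_nonneg fun l _ => M.P_nonneg i a l

end DMDP

/-- One round of bisection for `u` in the table `c`. -/
noncomputable def bisectStep (c : ℕ → ℝ) (u : ℝ) (p : ℕ × ℕ) : ℕ × ℕ :=
  if u < c ((p.1 + p.2) / 2) then (p.1, (p.1 + p.2) / 2) else ((p.1 + p.2) / 2, p.2)

/-- The interval of indices that is left after `k` rounds of bisection. -/
noncomputable def DMDP.bisect (M : DMDP n m) (i : Fin n) (a : Fin m) (u : ℝ) (k : ℕ) : ℕ × ℕ :=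
  (bisectStep (M.cum i a) u)^[k] (0, n)

namespace DMDP

theorem bisect_succ (M : DMDP n m) (i : Fin n) (a : Fin m) (u : ℝ) (k : ℕ) :
    M.bisect i a u (k + 1) = bisectStep (M.cum i a) u (M.bisect i a u k) :=
  Function.iterate_succ_apply' ..

/-- No condition on `u` is imposed, so that `next` is a total function into `Fin n`. -/
theorem bisect_lt (M : DMDP n m) (i : Fin n) (a : Fin m) (u : ℝ) (k : ℕ) :
    (M.bisect i a u k).1 < n ∧ (M.bisect i a u k).2 ≤ n := by
  induction k with
  | zero => exact ⟨i.pos, le_rfl⟩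
  | succ k ih =>
    rw [bisect_succ, bisectStep]
    split_ifs
    · exact ⟨ih.1, by dsimp only; omega⟩
    · exact ⟨by dsimp only; omega, ih.2⟩

/-- Bisection invariant with `d` rounds left: `u` lies between the partial sums at the two ends, and
the width is at most `2 ^ d`. The alternative of right end `n` covers `u = 1`, which does not lie
strictly below the full sum. -/
theorem bisect_spec (M : DMDP n m) (i : Fin n) (a : Fin m) {u : ℝ} (hu : 0 ≤ u) (d k : ℕ)
    (hn : n ≤ 2 ^ (k + d)) :
    (M.bisect i a u k).1 < (M.bisect i a u k).2 ∧
      (M.bisect i a u k).2 ≤ (M.bisect i a u k).1 + 2 ^ d ∧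
      M.cum i a (M.bisect i a u k).1 ≤ u ∧
      ((M.bisect i a u k).2 = n ∨ u < M.cum i a (M.bisect i a u k).2) := by
  induction k generalizing d with
  | zero =>
    rw [zero_add] at hn
    exact ⟨i.pos, by simpa [bisect] using hn, by simpa [bisect, cum_zero] using hu, Or.inl rfl⟩
  | succ k ih =>
    obtain ⟨h1, h2, h3, h4⟩ := ih (d + 1) (by rwa [add_right_comm] at hn)
    rw [pow_succ] at h2
    have hd : 0 < 2 ^ d := by positivity
    rw [bisect_succ, bisectStep]
    split_ifs with hc
    · refine ⟨?_, by dsimp only; omega, h3, Or.inr hc⟩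
      dsimp only
      -- A midpoint equal to the left end would give `u < cum lo`, against the invariant. So an
      -- interval of length one survives surplus rounds.
      by_contra hle
      have : ((M.bisect i a u k).1 + (M.bisect i a u k).2) / 2 = (M.bisect i a u k).1 := by omega
      rw [this] at hc
      exact absurd hc (not_lt.2 h3)
    · exact ⟨by dsimp only; omega, by dsimp only; omega, not_lt.1 hc, h4⟩

/-- The state that the generative model returns when the random number is `u`. -/
noncomputable def next (M : DMDP n m) (i : Fin n) (a : Fin m) (u : ℝ) : Fin n :=
  ⟨(M.bisect i a u (Nat.clog 2 n)).1, (M.bisect_lt i a u _).1⟩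

theorem next_spec (M : DMDP n m) (i : Fin n) (a : Fin m) {u : ℝ} (hu : 0 ≤ u) :
    M.cum i a (M.next i a u) ≤ u ∧
      ((M.next i a u : ℕ) + 1 = n ∨ u < M.cum i a (M.next i a u + 1)) := by
  obtain ⟨h1, h2, h3, h4⟩ := M.bisect_spec i a hu 0 (Nat.clog 2 n)
    (Nat.le_pow_clog one_lt_two n)
  have e : (M.bisect i a u (Nat.clog 2 n)).2 = (M.next i a u : ℕ) + 1 := by
    have : (M.next i a u : ℕ) = (M.bisect i a u (Nat.clog 2 n)).1 := rfl
    omega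
  rw [e] at h4
  exact ⟨h3, h4⟩

/-- Two indices that both satisfy the condition coincide: by monotonicity of the partial sums,
neither can exceed the other. -/
theorem next_eq_iff (M : DMDP n m) (i : Fin n) (a : Fin m) {u : ℝ} (hu : 0 ≤ u) (j : Fin n) :
    M.next i a u = j ↔ M.cum i a j ≤ u ∧ ((j : ℕ) + 1 = n ∨ u < M.cum i a (j + 1)) := by
  have h := M.next_spec i a hu
  refine ⟨fun e => e ▸ h, fun hj => ?_⟩
  have key (k l : Fin n) (hk : (k : ℕ) + 1 = n ∨ u < M.cum i a (k + 1))
      (hl : M.cum i a l ≤ u) : (l : ℕ) ≤ k := by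
    by_contra hlt
    rcases hk with hk | hk
    · omega
    · exact absurd (hk.trans_le ((M.cum_mono i a (show (k : ℕ) + 1 ≤ l by omega)).trans hl))
        (lt_irrefl _)
  exact Fin.ext (le_antisymm (key _ _ hj.2 h.1) (key _ _ h.2 hj.1))

/-- The last state owns a closed interval because `u = 1` falls to it, every other state a half-open
one. Both have length `P i a j`. -/
theorem volume_next_eq (M : DMDP n m) (i : Fin n) (a : Fin m) (j : Fin n) :
    volume {u : ℝ | u ∈ Set.Icc (0 : ℝ) 1 ∧ M.next i a u = j} = ENNReal.ofReal (M.P i a j) := by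
  have h1 : M.cum i a (j + 1) ≤ 1 := M.cum_card i a ▸ M.cum_mono i a j.isLt
  have h0 := M.cum_nonneg i a j
  have hP : M.P i a j = M.cum i a (j + 1) - M.cum i a j := by rw [M.cum_succ]; ring
  by_cases hj : (j : ℕ) + 1 = n
  · have : {u : ℝ | u ∈ Set.Icc (0 : ℝ) 1 ∧ M.next i a u = j} =
        Set.Icc (M.cum i a j) (M.cum i a (j + 1)) := by
      ext u
      rw [hj, M.cum_card]
      constructor
      · rintro ⟨hu, he⟩
        exact ⟨((M.next_eq_iff i a hu.1 j).1 he).1, hu.2⟩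
      · rintro ⟨h2, h3⟩
        exact ⟨⟨h0.trans h2, h3⟩, (M.next_eq_iff i a (h0.trans h2) j).2 ⟨h2, Or.inl hj⟩⟩
    rw [this, Real.volume_Icc, hP]
  · have : {u : ℝ | u ∈ Set.Icc (0 : ℝ) 1 ∧ M.next i a u = j} =
        Set.Ico (M.cum i a j) (M.cum i a (j + 1)) := by
      ext u
      constructor
      · rintro ⟨hu, he⟩
        have h := (M.next_eq_iff i a hu.1 j).1 he
        exact ⟨h.1, h.2.resolve_left hj⟩
      · rintro ⟨h2, h3⟩
        exact ⟨⟨h0.trans h2, h3.le.trans h1⟩,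
          (M.next_eq_iff i a (h0.trans h2) j).2 ⟨h2, Or.inr h3⟩⟩
    rw [this, Real.volume_Ico, hP]

theorem measurable_next (M : DMDP n m) (i : Fin n) (a : Fin m) : Measurable (M.next i a) := by
  have h (k : ℕ) : Measurable fun u => M.bisect i a u k := by
    induction k with
    | zero => exact measurable_const
    | succ k ih =>
      simp only [bisect_succ, bisectStep]
      refine Measurable.ite (measurableSet_lt measurable_id ?_) ?_ ?_
      · exact (measurable_of_countable fun p : ℕ × ℕ => M.cum i a ((p.1 + p.2) / 2)).comp ih
      · exact (measurable_of_countable fun p : ℕ × ℕ => (p.1, (p.1 + p.2) / 2)).comp ih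
      · exact (measurable_of_countable fun p : ℕ × ℕ => ((p.1 + p.2) / 2, p.2)).comp ih
  refine measurable_to_countable' fun j => ?_
  have e : M.next i a ⁻¹' {j} = (fun u => M.bisect i a u (Nat.clog 2 n)) ⁻¹' {p | p.1 = j} := by
    ext u
    simp [next, Fin.ext_iff]
  rw [e]
  exact h _ (Set.to_countable _).measurableSet

end DMDP

end

section

/-! ## Semantics of the programs -/

variable {n m : ℕ}

section exec

variable (tape : ℕ → ℝ) (s : State)

theorem exec_skip : exec tape .skip s = s := rfl

theorem exec_seq (c d : Cmd) : exec tape (.seq c d) s = exec tape d (exec tape c s) := rfl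

theorem exec_setN (x : NReg) (e : NExp) : exec tape (.setN x e) s =
    { s with nreg := Function.update s.nreg x (e.eval s), time := s.time + e.cost + 1 } := rfl

theorem exec_setR (x : RReg) (e : RExp) : exec tape (.setR x e) s =
    { s with rreg := Function.update s.rreg x (e.eval s), time := s.time + e.cost + 1 } := rfl

theorem exec_putN (A : NArr) (e f : NExp) : exec tape (.putN A e f) s =
    { s with
      narr := Function.update s.narr A (Function.update (s.narr A) (e.eval s) (f.eval s))
      time := s.time + e.cost + f.cost + 1 } := rfl

theorem exec_putR (A : RArr) (e : NExp) (f : RExp) : exec tape (.putR A e f) s =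
    { s with
      rarr := Function.update s.rarr A (Function.update (s.rarr A) (e.eval s) (f.eval s))
      time := s.time + e.cost + f.cost + 1 } := rfl

theorem exec_draw (x : RReg) : exec tape (.draw x) s =
    { s with
      rreg := Function.update s.rreg x (tape s.pos), pos := s.pos + 1, time := s.time + 1 } := rfl

theorem exec_ifN (e f : NExp) (c d : Cmd) : exec tape (.ifN e f c d) s =
    if e.eval s < f.eval s
    then exec tape c { s with time := s.time + e.cost + f.cost + 1 }
    else exec tape d { s with time := s.time + e.cost + f.cost + 1 } := rfl

theorem exec_ifR (e f : RExp) (c d : Cmd) : exec tape (.ifR e f c d) s =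
    if e.eval s < f.eval s
    then exec tape c { s with time := s.time + e.cost + f.cost + 1 }
    else exec tape d { s with time := s.time + e.cost + f.cost + 1 } := rfl

/-- Invariant rule for loops, indexed by the number of finished rounds. As the invariant sees the
whole machine state, it can record the running time along with the contents. -/
theorem exec_loop_induction (x : NReg) (e : NExp) (c : Cmd)
    (I : ℕ → State → Prop) (h0 : I 0 { s with time := s.time + e.cost + 1 })
    (hs : ∀ k < e.eval s, ∀ s', I k s' → I (k + 1) (exec tape c
      { s' with nreg := Function.update s'.nreg x k, time := s'.time + 1 })) :
    I (e.eval s) (exec tape (.loop x e c) s) := by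
  have h (N : ℕ) (hN : N ≤ e.eval s) : I N ((List.range N).foldl
      (fun s' k => exec tape c
        { s' with nreg := Function.update s'.nreg x k, time := s'.time + 1 })
      { s with time := s.time + e.cost + 1 }) := by
    induction N with
    | zero => exact h0
    | succ N ih =>
      rw [List.range_succ, List.foldl_append]
      exact hs N hN _ (ih (by omega))
  rw [exec]
  exact h _ le_rfl

end exec

/-- The memory holds what the generative model needs. -/
structure IsBuilt (M : DMDP n m) (s : State) : Prop where
  numS : s.nreg .numS = n
  numA : s.nreg .numA = m
  depth : s.nreg .depth = Nat.clog 2 n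
  cum : ∀ (i : Fin n) (a : Fin m) (j : ℕ), j < n →
    s.rarr .cum ((i * m + a) * n + j) = M.cum i a j
  reward : s.rarr .reward = flatten M.r

theorem IsBuilt.congr {M : DMDP n m} {s s' : State} (h : IsBuilt M s)
    (hS : s'.nreg .numS = s.nreg .numS) (hA : s'.nreg .numA = s.nreg .numA)
    (hd : s'.nreg .depth = s.nreg .depth) (hc : s'.rarr .cum = s.rarr .cum)
    (hr : s'.rarr .reward = s.rarr .reward) : IsBuilt M s' :=
  ⟨hS.trans h.numS, hA.trans h.numA, hd.trans h.depth, fun i a j hj => hc ▸ h.cum i a j hj,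
    hr.trans h.reward⟩

/-- The bisection loop of the generative model. -/
def bisectLoop : Cmd :=
  .loop .b (.reg .depth)
    (.block [
      .setN .mid (.half (.add (.reg .lo) (.reg .hi))),
      .ifR (.reg .u) (.read .cum (.add (.reg .row) (.reg .mid)))
        (.setN .hi (.reg .mid))
        (.setN .lo (.reg .mid))])

/-- A round costs 8 in either branch: loop 1, midpoint 3, test 3, assignment 1. The last conjuncts
are frame conditions for the caller. -/
theorem exec_bisectLoop (M : DMDP n m) (tape : ℕ → ℝ) (s : State) (hs : IsBuilt M s) (i : Fin n)
    (a : Fin m) (hrow : s.nreg .row = (i * m + a) * n) (hlo : s.nreg .lo = 0)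
    (hhi : s.nreg .hi = n) :
    (exec tape bisectLoop s).nreg .lo = M.next i a (s.rreg .u) ∧
    (exec tape bisectLoop s).time = s.time + (1 + 8 * Nat.clog 2 n) ∧
    (exec tape bisectLoop s).pos = s.pos ∧
    (exec tape bisectLoop s).rarr = s.rarr ∧
    (exec tape bisectLoop s).narr = s.narr ∧
    (exec tape bisectLoop s).rreg = s.rreg ∧
    ∀ x, x ≠ .lo → x ≠ .hi → x ≠ .mid → x ≠ .b →
      (exec tape bisectLoop s).nreg x = s.nreg x := by
  have h := exec_loop_induction tape s .b (.reg .depth)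
    (.block [
      .setN .mid (.half (.add (.reg .lo) (.reg .hi))),
      .ifR (.reg .u) (.read .cum (.add (.reg .row) (.reg .mid)))
        (.setN .hi (.reg .mid))
        (.setN .lo (.reg .mid))])
    (fun k s' => (s'.nreg .lo, s'.nreg .hi) = M.bisect i a (s.rreg .u) k ∧
      s'.time = s.time + (1 + 8 * k) ∧ s'.pos = s.pos ∧ s'.rarr = s.rarr ∧ s'.narr = s.narr ∧
      s'.rreg = s.rreg ∧
      ∀ x, x ≠ .lo → x ≠ .hi → x ≠ .mid → x ≠ .b → s'.nreg x = s.nreg x)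
    (by simp [hlo, hhi, NExp.cost, DMDP.bisect])
    (by
      rintro k - s' ⟨h1, h2, h3, h4, h5, h6, h7⟩
      have hr : s'.nreg .row = (i * m + a) * n := by
        rw [h7 _ (by simp) (by simp) (by simp) (by simp), hrow]
      have hb := M.bisect_lt i a (s.rreg .u) k
      rw [← h1] at hb
      dsimp only at hb
      have hc := hs.cum i a ((s'.nreg .lo + s'.nreg .hi) / 2) (by omega)
      rw [DMDP.bisect_succ, bisectStep, ← h1]
      simp only [Cmd.block, exec_seq, exec_setN, exec_ifR, exec_skip, NExp.eval, RExp.eval,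
        NExp.cost, RExp.cost]
      simp only [ne_eq, reduceCtorEq, not_false_eq_true, Function.update_of_ne,
        Function.update_self, hr, h4, hc, h6]
      split_ifs with hlt
      all_goals
        refine ⟨?_, ?_, h3, rfl, h5, rfl, fun x hx1 hx2 hx3 hx4 => ?_⟩
        · simp
        · dsimp only; omega
        · simp [hx1, hx2, hx3, hx4, h7])
  simp only [NExp.eval, hs.depth] at h
  obtain ⟨h1, h2⟩ := h
  exact ⟨congrArg Prod.fst h1, h2⟩

theorem exec_callGM (M : DMDP n m) (tape : ℕ → ℝ) (s : State) (hs : IsBuilt M s) (i : Fin n)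
    (a : Fin m) (hi : s.nreg .i = i) (ha : s.nreg .a = a) :
    (exec tape callGM s).nreg .lo = M.next i a (tape s.pos) ∧
    (exec tape callGM s).rreg .rew = M.r i a (M.next i a (tape s.pos)) ∧
    (exec tape callGM s).time = s.time + (11 + 8 * Nat.clog 2 n) ∧
    (exec tape callGM s).pos = s.pos + 1 ∧
    (exec tape callGM s).rarr = s.rarr ∧
    (exec tape callGM s).narr = s.narr ∧
    (∀ x, x ≠ .row → x ≠ .lo → x ≠ .hi → x ≠ .mid → x ≠ .b →
      (exec tape callGM s).nreg x = s.nreg x) ∧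
    (∀ x, x ≠ .u → x ≠ .rew → (exec tape callGM s).rreg x = s.rreg x) := by
  set s1 := exec tape (.setN .hi (.reg .numS)) (exec tape (.setN .lo (.lit 0)) (exec tape (.draw .u)
    (exec tape setRow s))) with hs1
  simp only [setRow, exec_setN, exec_draw, NExp.eval, NExp.cost, ne_eq, reduceCtorEq,
    not_false_eq_true, Function.update_of_ne, hs.numS, hs.numA, hi, ha] at hs1
  have hrow : s1.nreg .row = (i * m + a) * n := by simp [hs1]
  obtain ⟨h1, h2, h3, h4, h5, h6, h7⟩ := exec_bisectLoop M tape s1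
    (hs.congr (by simp [hs1]) (by simp [hs1]) (by simp [hs1]) (by simp [hs1]) (by simp [hs1]))
    i a hrow (by simp [hs1]) (by simp [hs1])
  set s2 := exec tape bisectLoop s1 with hs2
  have e : exec tape callGM s =
      exec tape (.setR .rew (.read .reward (.add (.reg .row) (.reg .lo)))) s2 := rfl
  have hu : s1.rreg .u = tape s.pos := by simp [hs1]
  rw [hu] at h1
  have hrow2 : s2.nreg .row = (i * m + a) * n := by
    rw [h7 _ (by simp) (by simp) (by simp) (by simp), hrow]
  have hr1 : s1.rarr = s.rarr := by simp [hs1]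
  rw [e]
  simp only [exec_setR, NExp.eval, RExp.eval, NExp.cost, RExp.cost, Function.update_self]
  refine ⟨h1, ?_, ?_, ?_, ?_, ?_, fun x hx1 hx2 hx3 hx4 hx5 => ?_, fun x hx1 hx2 => ?_⟩
  · rw [hrow2, h1, h4, hr1, hs.reward, flatten_apply]
  · rw [h2, hs1]; dsimp only; omega
  · rw [h3, hs1]
  · rw [h4, hr1]
  · rw [h5, hs1]
  · rw [h7 _ hx2 hx3 hx4 hx5, hs1]; simp [hx1, hx2, hx3]
  · simp [hx2, h6, hs1, hx1]

end

/-! ### Correctness and cost of the preprocessing and of one iteration -/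

section

variable {n m : ℕ}

/-- The memory holds the description of `M`, and the partial sums of the first `N` rows have been
stored. -/
structure IsFilled (M : DMDP n m) (N : ℕ) (s : State) : Prop where
  numS : s.nreg .numS = n
  numA : s.nreg .numA = m
  gamma : s.rreg .gamma = M.γ
  prob : s.rarr .prob = flatten M.P
  reward : s.rarr .reward = flatten M.r
  cum : ∀ (i : Fin n) (a : Fin m) (j : ℕ), (i * m + a : ℕ) < N → j < n →
    s.rarr .cum ((i * m + a) * n + j) = M.cum i a j

theorem IsFilled.congr {M : DMDP n m} {N : ℕ} {s s' : State} (h : IsFilled M N s)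
    (hS : s'.nreg .numS = s.nreg .numS) (hA : s'.nreg .numA = s.nreg .numA)
    (hg : s'.rreg .gamma = s.rreg .gamma) (hr : s'.rarr = s.rarr) : IsFilled M N s' :=
  ⟨hS.trans h.numS, hA.trans h.numA, hg.trans h.gamma, hr ▸ h.prob, hr ▸ h.reward, hr ▸ h.cum⟩

/-- The loop that stores the partial sums of a row. -/
def rowLoop : Cmd :=
  .loop .j (.reg .numS)
    (.block [
      .putR .cum (.add (.reg .row) (.reg .j)) (.reg .acc),
      .setR .acc (.add (.reg .acc) (.read .prob (.add (.reg .row) (.reg .j))))])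

/-- The accumulator is stored before `P i a k` is added to it, so entry `k` receives the sum over `l
< k`. -/
theorem exec_rowLoop (M : DMDP n m) (tape : ℕ → ℝ) (s : State) (i : Fin n) (a : Fin m)
    (hs : IsFilled M (i * m + a) s) (hrow : s.nreg .row = (i * m + a) * n)
    (hacc : s.rreg .acc = 0) :
    IsFilled M (i * m + a + 1) (exec tape rowLoop s) ∧
    (exec tape rowLoop s).time = s.time + (1 + 7 * n) ∧
    ∀ x, x ≠ .j → (exec tape rowLoop s).nreg x = s.nreg x := by
  have h := exec_loop_induction tape s .j (.reg .numS)
    (.block [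
      .putR .cum (.add (.reg .row) (.reg .j)) (.reg .acc),
      .setR .acc (.add (.reg .acc) (.read .prob (.add (.reg .row) (.reg .j))))])
    (fun k s' => IsFilled M (i * m + a) s' ∧ s'.time = s.time + (1 + 7 * k) ∧
      s'.rreg .acc = M.cum i a k ∧
      (∀ j < k, s'.rarr .cum ((i * m + a) * n + j) = M.cum i a j) ∧
      ∀ x, x ≠ .j → s'.nreg x = s.nreg x)
    ⟨hs.congr rfl rfl rfl rfl, by simp [NExp.cost], by simp [hacc, DMDP.cum_zero], by simp,
      fun _ _ => rfl⟩
    (by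
      rintro k hk s' ⟨h1, h2, h3, h4, h5⟩
      have hr : s'.nreg .row = (i * m + a) * n := by rw [h5 _ (by simp), hrow]
      have hkn : k < n := by simpa [NExp.eval, hs.numS] using hk
      have hP : s'.rarr .prob ((i * m + a) * n + k) = M.P i a ⟨k, hkn⟩ := by
        rw [h1.prob]; exact flatten_apply M.P i a ⟨k, hkn⟩
      simp only [Cmd.block, exec_seq, exec_putR, exec_setR, exec_skip, NExp.eval, RExp.eval,
        NExp.cost, RExp.cost]
      simp only [ne_eq, reduceCtorEq, not_false_eq_true, Function.update_of_ne,
        Function.update_self, hr, h3, hP]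
      refine ⟨⟨?_, ?_, ?_, ?_, ?_, fun i' a' j hN hj => ?_⟩, ?_, ?_, fun j hj => ?_,
        fun x hx => ?_⟩
      · simp [h1.numS]
      · simp [h1.numA]
      · simp [h1.gamma]
      · simp [h1.prob]
      · simp [h1.reward]
      -- Earlier rows end before address `(i * m + a) * n`, so writing into the current row leaves
      -- them intact.
      · have : ((i' : ℕ) * m + a' + 1) * n ≤ (i * m + a) * n := Nat.mul_le_mul_right _ hN
        rw [add_mul, one_mul] at this
        simp only [Function.update_self]
        rw [Function.update_of_ne (by omega), h1.cum i' a' j hN hj]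
      · omega
      · rw [M.cum_succ i a ⟨k, hkn⟩]
      · rcases Nat.lt_succ_iff_lt_or_eq.1 hj with hj | rfl
        · rw [Function.update_of_ne (by omega), h4 j hj]
        · rw [Function.update_self]
      · simp [hx, h5])
  simp only [NExp.eval, hs.numS] at h
  obtain ⟨h1, h2, -, h4, h5⟩ := h
  refine ⟨⟨h1.numS, h1.numA, h1.gamma, h1.prob, h1.reward, fun i' a' j hN hj => ?_⟩, h2, h5⟩
  rcases Nat.lt_succ_iff_lt_or_eq.1 hN with hN | hN
  · exact h1.cum i' a' j hN hj
  -- Division with remainder by `m` recovers the pair from its row number.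
  · have e : a' = a ∧ i' = i := by
      have hm : 0 < m := a.pos
      have h1 := congrArg (· / m) hN
      have h2 := congrArg (· % m) hN
      simp only [mul_comm _ m, Nat.mul_add_mod, Nat.mul_add_div hm, Nat.mod_eq_of_lt a.isLt,
        Nat.mod_eq_of_lt a'.isLt, Nat.div_eq_of_lt a.isLt, Nat.div_eq_of_lt a'.isLt] at h1 h2
      exact ⟨Fin.ext h2, Fin.ext (by omega)⟩
    obtain ⟨rfl, rfl⟩ := e
    exact h4 j hj

/-- The loop over the actions in the preprocessing. -/
def actionLoop : Cmd :=
  .loop .a (.reg .numA) (.block [setRow, .setR .acc (.ofN (.lit 0)), rowLoop])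

theorem exec_actionLoop (M : DMDP n m) (tape : ℕ → ℝ) (s : State) (i : Fin n)
    (hs : IsFilled M (i * m) s) (hi : s.nreg .i = i) :
    IsFilled M ((i + 1) * m) (exec tape actionLoop s) ∧
    (exec tape actionLoop s).time = s.time + (1 + (8 + 7 * n) * m) := by
  have h := exec_loop_induction tape s .a (.reg .numA)
    (.block [setRow, .setR .acc (.ofN (.lit 0)), rowLoop])
    (fun k s' => IsFilled M (i * m + k) s' ∧ s'.time = s.time + (1 + (8 + 7 * n) * k) ∧
      s'.nreg .i = i)
    ⟨hs.congr rfl rfl rfl rfl, by simp [NExp.cost], hi⟩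
    (by
      rintro k hk s' ⟨h1, h2, h3⟩
      have hkm : k < m := by simpa [NExp.eval, hs.numA] using hk
      simp only [Cmd.block, exec_seq, exec_skip]
      set s1 := exec tape (.setR .acc (.ofN (.lit 0))) (exec tape setRow
        { s' with nreg := Function.update s'.nreg .a k, time := s'.time + 1 }) with hs1
      simp only [setRow, exec_setN, exec_setR, NExp.eval, NExp.cost, RExp.eval, RExp.cost, ne_eq,
        reduceCtorEq, not_false_eq_true, Function.update_of_ne, Function.update_self, h1.numS,
        h1.numA, h3] at hs1
      obtain ⟨r1, r2, r3⟩ := exec_rowLoop M tape s1 i ⟨k, hkm⟩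
        (h1.congr (by simp [hs1]) (by simp [hs1]) (by simp [hs1]) (by simp [hs1]))
        (by simp [hs1]) (by simp [hs1])
      refine ⟨r1, ?_, ?_⟩
      · rw [r2, hs1, mul_add]; dsimp only; omega
      · rw [r3 _ (by simp), hs1]; simp [h3])
  simp only [NExp.eval, hs.numA] at h
  obtain ⟨h1, h2, -⟩ := h
  rw [add_mul, one_mul]
  exact ⟨h1, h2⟩

/-- The part of the preprocessing that stores the partial sums. -/
def cumLoop : Cmd := .loop .i (.reg .numS) actionLoop

theorem exec_cumLoop (M : DMDP n m) (tape : ℕ → ℝ) (s : State) (hs : IsFilled M 0 s) :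
    IsFilled M (n * m) (exec tape cumLoop s) ∧
    (exec tape cumLoop s).time = s.time + (1 + (2 + (8 + 7 * n) * m) * n) := by
  have h := exec_loop_induction tape s .i (.reg .numS) actionLoop
    (fun k s' => IsFilled M (k * m) s' ∧ s'.time = s.time + (1 + (2 + (8 + 7 * n) * m) * k))
    ⟨by rw [zero_mul]; exact hs.congr rfl rfl rfl rfl, by simp [NExp.cost]⟩
    (by
      rintro k hk s' ⟨h1, h2⟩
      have hkn : k < n := by simpa [NExp.eval, hs.numS] using hk
      obtain ⟨r1, r2⟩ := exec_actionLoop M tape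
        { s' with nreg := Function.update s'.nreg .i k, time := s'.time + 1 } ⟨k, hkn⟩
        (h1.congr (by simp) (by simp) rfl rfl) (by simp)
      refine ⟨r1, ?_⟩
      rw [r2, mul_add _ k]; dsimp only; omega)
  simp only [NExp.eval, hs.numS] at h
  exact h

/-- The part of the preprocessing that computes the depth of the bisection. -/
def depthLoop : Cmd :=
  .loop .j (.reg .numS)
    (.ifN (.reg .width) (.reg .numS)
      (.block [
        .setN .width (.add (.reg .width) (.reg .width)),
        .setN .depth (.add (.reg .depth) (.lit 1))])
      .skip)

/-- The width stays `2 ^ depth`, and the depth grows by one per round until it reaches `Nat.clog 2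
n`. Since `Nat.clog 2 n ≤ n`, the `n` rounds suffice. -/
theorem exec_depthLoop (tape : ℕ → ℝ) (s : State) (hS : s.nreg .numS = n)
    (hw : s.nreg .width = 1) (hd : s.nreg .depth = 0) :
    (exec tape depthLoop s).nreg .depth = Nat.clog 2 n ∧
    (exec tape depthLoop s).time ≤ s.time + (1 + 6 * n) ∧
    (exec tape depthLoop s).rarr = s.rarr ∧ (exec tape depthLoop s).rreg = s.rreg ∧
    (exec tape depthLoop s).nreg .numS = s.nreg .numS ∧
    (exec tape depthLoop s).nreg .numA = s.nreg .numA := by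
  have h := exec_loop_induction tape s .j (.reg .numS)
    (.ifN (.reg .width) (.reg .numS)
      (.block [
        .setN .width (.add (.reg .width) (.reg .width)),
        .setN .depth (.add (.reg .depth) (.lit 1))])
      .skip)
    (fun k s' => (s'.nreg .width = 2 ^ s'.nreg .depth ∧ s'.nreg .depth = min k (Nat.clog 2 n)) ∧
      s'.time ≤ s.time + (1 + 6 * k) ∧ s'.rarr = s.rarr ∧ s'.rreg = s.rreg ∧
      s'.nreg .numS = s.nreg .numS ∧ s'.nreg .numA = s.nreg .numA)
    (by simp [hw, hd, NExp.cost])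
    (by
      rintro k - s' ⟨⟨h1, h2⟩, h3, h4, h5, h6, h7⟩
      have hiff : 2 ^ s'.nreg .depth < n ↔ s'.nreg .depth < Nat.clog 2 n :=
        (Nat.lt_clog_iff_pow_lt one_lt_two).symm
      simp only [exec_ifN, Cmd.block, exec_seq, exec_setN, exec_skip, NExp.eval, NExp.cost, ne_eq,
        reduceCtorEq, not_false_eq_true, Function.update_of_ne, h1, h6, hS]
      split_ifs with hc <;> rw [hiff] at hc
      · refine ⟨⟨?_, ?_⟩, ?_, h4, h5, ?_, ?_⟩
        · simp [pow_succ, mul_two]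
        · simp only [Function.update_self]; omega
        · dsimp only; omega
        · simp [h6, hS]
        · simp [h7]
      · refine ⟨⟨?_, ?_⟩, ?_, h4, h5, ?_, ?_⟩
        · simp [h1]
        · simp only [ne_eq, reduceCtorEq, not_false_eq_true, Function.update_of_ne]; omega
        · dsimp only; omega
        · simp [h6, hS]
        · simp [h7])
  simp only [NExp.eval, hS] at h
  obtain ⟨⟨-, h2⟩, h3⟩ := h
  have : Nat.clog 2 n ≤ n := (Nat.clog_le_iff_le_pow one_lt_two).2 Nat.lt_two_pow_self.le
  refine ⟨h2.trans (min_eq_right this), ?_⟩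
  rw [hS]
  exact h3

theorem builtState_spec (M : DMDP n m) :
    IsBuilt M (builtState M) ∧ (builtState M).rreg .gamma = M.γ ∧
    (builtState M).time ≤ 4 + (8 + (8 + 7 * n) * m) * n := by
  have h0 : IsFilled M 0 (inputState M) := ⟨rfl, rfl, rfl, rfl, rfl, fun _ _ _ h => by omega⟩
  obtain ⟨h1, h2⟩ := exec_cumLoop M (fun _ => 0) _ h0
  set s1 := exec (fun _ => 0) cumLoop (inputState M) with hs1
  set s2 := exec (fun _ => 0) (.setN .depth (.lit 0)) (exec (fun _ => 0) (.setN .width (.lit 1)) s1)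
    with hs2
  have e : builtState M = exec (fun _ => 0) depthLoop s2 := rfl
  simp only [exec_setN, NExp.eval, NExp.cost] at hs2
  have h3 : IsFilled M (n * m) s2 :=
    h1.congr (by simp [hs2]) (by simp [hs2]) (by simp [hs2]) (by simp [hs2])
  obtain ⟨d1, d2, d3, d4, d5, d6⟩ := exec_depthLoop (n := n) (fun _ => 0) s2 h3.numS
    (by simp [hs2]) (by simp [hs2])
  rw [e]
  refine ⟨⟨d5.trans h3.numS, d6.trans h3.numA, d1, fun i a j hj => ?_, d3 ▸ h3.reward⟩,
    d4 ▸ h3.gamma, ?_⟩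
  · rw [d3]
    refine h3.cum i a j ?_ hj
    calc (i * m + a : ℕ) < i * m + m := by omega
      _ = (i + 1) * m := by ring
      _ ≤ n * m := Nat.mul_le_mul_right _ i.isLt
  · have t0 : (inputState M).time = 0 := rfl
    have t2 : s2.time = s1.time + 2 := by simp [hs2]
    rw [t2, h2, t0] at d2
    refine d2.trans (le_of_eq ?_)
    ring

theorem callState_spec (M : DMDP n m) (i : Fin n) (a : Fin m) (u : ℝ) :
    (callState M i a u).nreg .lo = M.next i a u ∧
    (callState M i a u).rreg .rew = M.r i a (M.next i a u) ∧
    (callState M i a u).time = (builtState M).time + (11 + 8 * Nat.clog 2 n) := by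
  obtain ⟨h1, h2, h3, -⟩ := exec_callGM M (fun _ => u) ((builtState M).select i a)
    ((builtState_spec M).1.congr (by simp [State.select]) (by simp [State.select])
      (by simp [State.select]) rfl rfl) i a (by simp [State.select]) (by simp [State.select])
  exact ⟨h1, h2, h3⟩

/-- The memory between two iterations. -/
structure IsReady (M : DMDP n m) (ε : ℝ) (K : ℕ) (s : State) : Prop where
  built : IsBuilt M s
  gamma : s.rreg .gamma = M.γ
  eps : s.rreg .eps = ε
  numK : s.nreg .numK = K

theorem exec_initShared (M : DMDP n m) (ε : ℝ) (K : ℕ) (tape : ℕ → ℝ) (s : State)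
    (hs : IsReady M ε K s) :
    IsReady M ε K (exec tape initShared s) ∧
    (exec tape initShared s).time = s.time + (1 + 4 * n) ∧
    (∀ j < n, (exec tape initShared s).rarr .value j = 0) ∧
    ∀ j < n, (exec tape initShared s).narr .policy j = 0 := by
  have h := exec_loop_induction tape s .i (.reg .numS)
    (.block [
      .putR .value (.reg .i) (.ofN (.lit 0)),
      .putN .policy (.reg .i) (.lit 0)])
    (fun k s' => IsReady M ε K s' ∧ s'.time = s.time + (1 + 4 * k) ∧
      (∀ j < k, s'.rarr .value j = 0) ∧ ∀ j < k, s'.narr .policy j = 0)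
    ⟨⟨hs.built.congr rfl rfl rfl rfl rfl, hs.gamma, hs.eps, hs.numK⟩, by simp [NExp.cost],
      by simp, by simp⟩
    (by
      rintro k - s' ⟨h1, h2, h3, h4⟩
      simp only [Cmd.block, exec_seq, exec_skip, exec_putR, exec_putN, NExp.eval, RExp.eval,
        NExp.cost, RExp.cost, Function.update_self]
      refine ⟨⟨h1.built.congr ?_ ?_ ?_ ?_ ?_, h1.gamma, h1.eps, ?_⟩, ?_, fun j hj => ?_,
        fun j hj => ?_⟩
      any_goals simp
      · exact h1.numK
      · omega
      all_goals
        rcases Nat.lt_succ_iff_lt_or_eq.1 hj with hj | rfl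
        · rw [Function.update_of_ne (by omega)]
          first | exact h3 j hj | exact h4 j hj
        · simp)
  simp only [NExp.eval, hs.built.numS] at h
  exact h

/-- The number `q` that is computed in an iteration for the pair `(i, a)` from the vector `w` and the
random numbers `u`. -/
noncomputable def DMDP.sampleValue (M : DMDP n m) (ε : ℝ) (K : ℕ) (i : Fin n) (a : Fin m)
    (w : Fin n → ℝ) (u : ℕ → ℝ) : ℝ :=
  (∑ k ∈ Finset.range K, M.r i a (M.next i a (u k))) / K +
    M.γ * ((∑ k ∈ Finset.range K, w (M.next i a (u k))) / K) - (1 - M.γ) * ε / 4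

/-- The sampling loop of an iteration. -/
def sampleLoop : Cmd :=
  .loop .k (.reg .numK)
    (.block [
      callGM,
      .setR .sumR (.add (.reg .sumR) (.reg .rew)),
      .setR .sumV (.add (.reg .sumV) (.read .view (.reg .lo)))])

/-- The invariant includes that the tape position equals `k`, so the `k`-th call consumes exactly
the number `tape k`. -/
theorem exec_sampleLoop (M : DMDP n m) (ε : ℝ) (K : ℕ) (tape : ℕ → ℝ) (s : State)
    (hs : IsReady M ε K s) (i : Fin n) (a : Fin m) (hi : s.nreg .i = i) (ha : s.nreg .a = a)
    (w : Fin n → ℝ) (hw : ∀ j : Fin n, s.rarr .view j = w j) (hp : s.pos = 0)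
    (hR : s.rreg .sumR = 0) (hV : s.rreg .sumV = 0) :
    IsReady M ε K (exec tape sampleLoop s) ∧
    (exec tape sampleLoop s).nreg .i = i ∧ (exec tape sampleLoop s).nreg .a = a ∧
    (exec tape sampleLoop s).rarr = s.rarr ∧ (exec tape sampleLoop s).narr = s.narr ∧
    (exec tape sampleLoop s).rreg .sumR = ∑ k ∈ Finset.range K, M.r i a (M.next i a (tape k)) ∧
    (exec tape sampleLoop s).rreg .sumV = ∑ k ∈ Finset.range K, w (M.next i a (tape k)) ∧
    (exec tape sampleLoop s).time = s.time + (1 + (17 + 8 * Nat.clog 2 n) * K) := by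
  have h := exec_loop_induction tape s .k (.reg .numK)
    (.block [
      callGM,
      .setR .sumR (.add (.reg .sumR) (.reg .rew)),
      .setR .sumV (.add (.reg .sumV) (.read .view (.reg .lo)))])
    (fun k s' => (IsReady M ε K s' ∧ s'.nreg .i = i ∧ s'.nreg .a = a ∧
      s'.rarr = s.rarr ∧ s'.narr = s.narr ∧
      s'.rreg .sumR = ∑ k ∈ Finset.range k, M.r i a (M.next i a (tape k)) ∧
      s'.rreg .sumV = ∑ k ∈ Finset.range k, w (M.next i a (tape k)) ∧
      s'.time = s.time + (1 + (17 + 8 * Nat.clog 2 n) * k)) ∧ s'.pos = k)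
    ⟨⟨⟨hs.built.congr rfl rfl rfl rfl rfl, hs.gamma, hs.eps, hs.numK⟩, hi, ha, rfl, rfl,
      by simp [hR], by simp [hV], by simp [NExp.cost]⟩, hp⟩
    (by
      rintro k - s' ⟨⟨h1, h2, h3, h4, h5, h6, h7, h8⟩, h9⟩
      simp only [Cmd.block, exec_seq, exec_skip]
      set s1 : State := { s' with nreg := Function.update s'.nreg .k k, time := s'.time + 1 }
        with hs1
      obtain ⟨c1, c2, c3, c4, c5, c6, c7, c8⟩ := exec_callGM M tape s1
        (h1.built.congr (by simp [hs1]) (by simp [hs1]) (by simp [hs1]) rfl rfl) i a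
        (by simp [hs1, h2]) (by simp [hs1, h3])
      have p1 : s1.pos = k := h9
      rw [p1] at c1 c2 c4
      set s2 := exec tape callGM s1 with hs2
      have b2 : IsBuilt M s2 := h1.built.congr
        (by rw [c7 _ (by simp) (by simp) (by simp) (by simp) (by simp), hs1]; simp)
        (by rw [c7 _ (by simp) (by simp) (by simp) (by simp) (by simp), hs1]; simp)
        (by rw [c7 _ (by simp) (by simp) (by simp) (by simp) (by simp), hs1]; simp)
        (by rw [c5]) (by rw [c5])
      have v2 : s2.rarr .view (M.next i a (tape k)) = w (M.next i a (tape k)) := by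
        rw [c5, ← hw]; exact congrFun (congrFun h4 _) _
      simp only [exec_setR, NExp.eval, RExp.eval, NExp.cost, RExp.cost, ne_eq, reduceCtorEq,
        not_false_eq_true, Function.update_of_ne, c1, c2, v2]
      rw [c8 _ (by simp) (by simp), c8 _ (by simp) (by simp)]
      refine ⟨⟨⟨b2.congr rfl rfl rfl rfl rfl, ?_, ?_, ?_⟩, ?_, ?_, ?_, ?_, ?_, ?_, ?_⟩, ?_⟩
      · simp only [ne_eq, reduceCtorEq, not_false_eq_true, Function.update_of_ne]
        rw [c8 _ (by simp) (by simp)]; exact h1.gamma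
      · simp only [ne_eq, reduceCtorEq, not_false_eq_true, Function.update_of_ne]
        rw [c8 _ (by simp) (by simp)]; exact h1.eps
      · rw [c7 _ (by simp) (by simp) (by simp) (by simp) (by simp), hs1]; simp [h1.numK]
      · rw [c7 _ (by simp) (by simp) (by simp) (by simp) (by simp), hs1]; simp [h2]
      · rw [c7 _ (by simp) (by simp) (by simp) (by simp) (by simp), hs1]; simp [h3]
      · rw [c5]; exact h4
      · rw [c6]; exact h5
      · rw [Finset.sum_range_succ, ← h6]; simp [hs1]
      · rw [Finset.sum_range_succ, ← h7]; simp [hs1]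
      · rw [c3, hs1, mul_add _ k]; dsimp only; omega
      · exact c4)
  simp only [NExp.eval, hs.numK] at h
  exact h.1

theorem exec_iteration (M : DMDP n m) (ε : ℝ) (K : ℕ) (tape : ℕ → ℝ) (s : State)
    (hs : IsReady M ε K s) (i : Fin n) (a : Fin m) (hi : s.nreg .i = i) (ha : s.nreg .a = a)
    (w : Fin n → ℝ) (hw : ∀ j : Fin n, s.rarr .view j = w j) (hp : s.pos = 0) :
    IsReady M ε K (exec tape iteration s) ∧
    (exec tape iteration s).time ≤ s.time + (22 + (17 + 8 * Nat.clog 2 n) * K) ∧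
    (∀ j : Fin n, (exec tape iteration s).rarr .value j =
      if j = i ∧ s.rarr .value j < M.sampleValue ε K i a w tape then
        M.sampleValue ε K i a w tape else s.rarr .value j) ∧
    (∀ j : Fin n, (exec tape iteration s).narr .policy j =
      if j = i ∧ s.rarr .value j < M.sampleValue ε K i a w tape then (a : ℕ)
      else s.narr .policy j) := by
  set s1 := exec tape (.setR .sumV (.ofN (.lit 0))) (exec tape (.setR .sumR (.ofN (.lit 0))) s)
    with hs1
  simp only [exec_setR, NExp.eval, NExp.cost, RExp.eval, RExp.cost] at hs1
  obtain ⟨h1, h2, h3, h4, h5, h6, h7, h8⟩ := exec_sampleLoop M ε K tape s1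
    ⟨hs.built.congr (by simp [hs1]) (by simp [hs1]) (by simp [hs1]) (by simp [hs1]) (by simp [hs1]),
      by simp [hs1, hs.gamma], by simp [hs1, hs.eps], by simp [hs1, hs.numK]⟩ i a
    (by simp [hs1, hi]) (by simp [hs1, ha]) w (by simpa [hs1] using hw) (by simp [hs1, hp])
    (by simp [hs1]) (by simp [hs1])
  set s2 := exec tape sampleLoop s1 with hs2
  have r1 : s1.rarr = s.rarr := by simp [hs1]
  have n1 : s1.narr = s.narr := by simp [hs1]
  have t1 : s1.time = s.time + 4 := by simp [hs1]
  have e : exec tape iteration s = exec tape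
    (.ifR (.read .value (.reg .i)) (.reg .q)
      (.block [.putR .value (.reg .i) (.reg .q), .putN .policy (.reg .i) (.reg .a)]) .skip)
    (exec tape (.setR .q
      (.sub
        (.add (.div (.reg .sumR) (.ofN (.reg .numK)))
          (.mul (.reg .gamma) (.div (.reg .sumV) (.ofN (.reg .numK)))))
        (.div (.mul (.sub (.ofN (.lit 1)) (.reg .gamma)) (.reg .eps)) (.ofN (.lit 4))))) s2) := rfl
  have hq : s2.rreg .sumR / (K : ℝ) + M.γ * (s2.rreg .sumV / K) - (((1 : ℕ) : ℝ) - M.γ) * ε /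
      ((4 : ℕ) : ℝ) = M.sampleValue ε K i a w tape := by
    rw [h6, h7, DMDP.sampleValue]; norm_num
  rw [e]
  simp only [exec_ifR, exec_setR, Cmd.block, exec_seq, exec_skip, exec_putR, exec_putN, NExp.eval,
    RExp.eval, NExp.cost, RExp.cost, Function.update_self, h1.gamma, h1.eps, h1.numK, hq, h2, h3,
    h4, h5, r1, n1]
  have b2 := h1.built
  have g2 := h1.gamma
  have e2 := h1.eps
  have k2 := h1.numK
  set q := M.sampleValue ε K i a w tape
  split_ifs with hc
  · refine ⟨⟨b2.congr rfl rfl rfl ?_ ?_, ?_, ?_, ?_⟩, ?_, fun j => ?_, fun j => ?_⟩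
    · simp [h4, r1]
    · simp [h4, r1]
    · simpa using g2
    · simpa using e2
    · exact k2
    · dsimp only; omega
    · by_cases hj : j = i
      · subst hj; simp [hc]
      · have : (j : ℕ) ≠ i := fun h => hj (Fin.ext h)
        simp [hj, this]
    · by_cases hj : j = i
      · subst hj; simp [hc]
      · have : (j : ℕ) ≠ i := fun h => hj (Fin.ext h)
        simp [hj, this]
  · refine ⟨⟨b2.congr rfl rfl rfl ?_ ?_, ?_, ?_, ?_⟩, ?_, fun j => ?_, fun j => ?_⟩
    · rw [h4, r1]
    · rw [h4, r1]
    · simpa using g2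
    · simpa using e2
    · exact k2
    · dsimp only; omega
    · rw [if_neg]; rintro ⟨rfl, h⟩; exact hc h
    · rw [if_neg]; rintro ⟨rfl, h⟩; exact hc h

end

section

/-! ## The run of the algorithm on the machine -/

variable {n m : ℕ}

theorem history_of_le (s₀ : State) (σ : Schedule n m) (U : ℕ → ℕ → ℝ) {s t : ℕ} (h : s ≤ t) :
    history s₀ σ U t s = history s₀ σ U s s := by
  induction t, h using Nat.le_induction with
  | base => rfl
  | succ t h ih => rw [history, Function.update_of_ne (by omega), ih]

/-- A forbidden read from the future finds the initial memory. Condition (b) holds only almost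
surely, whereas the cost bound and the measurability of the run concern every schedule, so such
reads need a value too. -/
theorem history_of_lt (s₀ : State) (σ : Schedule n m) (U : ℕ → ℕ → ℝ) {s t : ℕ} (h : t < s) :
    history s₀ σ U t s = s₀ := by
  induction t with
  | zero => rfl
  | succ t ih => rw [history, Function.update_of_ne (by omega), ih (by omega)]

/-- The memory at the start of the first iteration. -/
noncomputable def startState (M : DMDP n m) (ε : ℝ) (K : ℕ) : State :=
  exec (fun _ => 0) initShared
    { builtState M with
      nreg := Function.update (builtState M).nreg .numK K
      rreg := Function.update (builtState M).rreg .eps ε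
      time := (builtState M).time + 2 }

/-- The memory at the start of iteration `t`. -/
noncomputable def trace (M : DMDP n m) (ε : ℝ) (K : ℕ) (σ : Schedule n m) (U : ℕ → ℕ → ℝ)
    (t : ℕ) : State :=
  history (startState M ε K) σ U t t

/-- The shared vector at the start of iteration `t`. -/
noncomputable def valueAt (M : DMDP n m) (ε : ℝ) (K : ℕ) (σ : Schedule n m) (U : ℕ → ℕ → ℝ)
    (t : ℕ) (j : Fin n) : ℝ :=
  (trace M ε K σ U t).rarr .value j

/-- The vector that is read in iteration `t`. -/
noncomputable def readAt (M : DMDP n m) (ε : ℝ) (K : ℕ) (σ : Schedule n m) (U : ℕ → ℕ → ℝ)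
    (t : ℕ) (j : Fin n) : ℝ :=
  valueAt M ε K σ U (if σ.readTime t j ≤ t then σ.readTime t j else 0) j

/-- The number `q` that is computed in iteration `t`. -/
noncomputable def sampleAt (M : DMDP n m) (ε : ℝ) (K : ℕ) (σ : Schedule n m) (U : ℕ → ℕ → ℝ)
    (t : ℕ) : ℝ :=
  M.sampleValue ε K (σ.state t) (σ.action t) (readAt M ε K σ U t) (U t)

theorem startState_spec (M : DMDP n m) (ε : ℝ) (K : ℕ) :
    IsReady M ε K (startState M ε K) ∧
    (startState M ε K).time = (builtState M).time + (3 + 4 * n) ∧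
    (∀ j < n, (startState M ε K).rarr .value j = 0) ∧
    ∀ j < n, (startState M ε K).narr .policy j = 0 := by
  obtain ⟨h1, h2, -⟩ := builtState_spec M
  obtain ⟨r1, r2, r3⟩ := exec_initShared M ε K (fun _ => 0)
    { builtState M with
      nreg := Function.update (builtState M).nreg .numK K
      rreg := Function.update (builtState M).rreg .eps ε
      time := (builtState M).time + 2 }
    ⟨h1.congr (by simp) (by simp) (by simp) rfl rfl, by simp [h2], by simp, by simp⟩
  refine ⟨r1, ?_, r3⟩
  rw [startState, r2]
  dsimp only
  omega

variable (M : DMDP n m) (ε : ℝ) (K : ℕ) (σ : Schedule n m) (U : ℕ → ℕ → ℝ)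

theorem valueAt_zero (j : Fin n) : valueAt M ε K σ U 0 j = 0 :=
  (startState_spec M ε K).2.2.1 j j.isLt

theorem history_readTime (t : ℕ) (j : Fin n) :
    (history (startState M ε K) σ U t (σ.readTime t j)).rarr .value j = readAt M ε K σ U t j := by
  rw [readAt]
  split_ifs with h
  · rw [history_of_le _ _ _ h]; rfl
  · rw [history_of_lt _ _ _ (not_le.1 h)]; rfl

/-- The memory on which the body of iteration `t` is executed. -/
noncomputable def selected (t : ℕ) : State :=
  { (trace M ε K σ U t).select (σ.state t) (σ.action t) with
    rarr := Function.update ((trace M ε K σ U t).select (σ.state t) (σ.action t)).rarr .view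
      fun j => if h : j < n then
        (history (startState M ε K) σ U t (σ.readTime t ⟨j, h⟩)).rarr .value j else 0
    time := ((trace M ε K σ U t).select (σ.state t) (σ.action t)).time + 4 }

theorem trace_succ (t : ℕ) :
    trace M ε K σ U (t + 1) = exec (U t) iteration (selected M ε K σ U t) := by
  rw [trace, history, Function.update_self]
  rfl

theorem exec_selected (t : ℕ) (h : IsReady M ε K (trace M ε K σ U t)) :
    IsReady M ε K (trace M ε K σ U (t + 1)) ∧
    (trace M ε K σ U (t + 1)).time ≤
      (trace M ε K σ U t).time + (26 + (17 + 8 * Nat.clog 2 n) * K) ∧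
    (∀ j, valueAt M ε K σ U (t + 1) j =
      if j = σ.state t ∧ valueAt M ε K σ U t j < sampleAt M ε K σ U t
      then sampleAt M ε K σ U t else valueAt M ε K σ U t j) ∧
    (∀ j : Fin n, (trace M ε K σ U (t + 1)).narr .policy j =
      if j = σ.state t ∧ valueAt M ε K σ U t j < sampleAt M ε K σ U t
      then (σ.action t : ℕ) else (trace M ε K σ U t).narr .policy j) := by
  have hv : (selected M ε K σ U t).rarr .value = (trace M ε K σ U t).rarr .value := by
    simp [selected, State.select]
  obtain ⟨h1, h2, h3, h4⟩ := exec_iteration M ε K (U t) (selected M ε K σ U t)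
    ⟨h.built.congr (by simp [selected, State.select]) (by simp [selected, State.select])
      (by simp [selected, State.select]) (by simp [selected, State.select])
      (by simp [selected, State.select]),
      h.gamma, h.eps, by simp [selected, State.select, h.numK]⟩
    (σ.state t) (σ.action t) (by simp [selected, State.select]) (by simp [selected, State.select])
    (readAt M ε K σ U t)
    (fun j => by
      rw [← history_readTime]
      simp only [selected, Function.update_self, j.isLt, dite_true, Fin.eta])
    rfl
  rw [hv] at h3 h4
  simp only [valueAt, trace_succ]
  refine ⟨h1, h2.trans (le_of_eq ?_), h3, h4⟩
  have : (selected M ε K σ U t).time = (trace M ε K σ U t).time + 4 := rfl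
  omega

theorem isReady_trace (t : ℕ) : IsReady M ε K (trace M ε K σ U t) := by
  induction t with
  | zero => exact (startState_spec M ε K).1
  | succ t ih => exact (exec_selected M ε K σ U t ih).1

theorem valueAt_succ (t : ℕ) (j : Fin n) : valueAt M ε K σ U (t + 1) j =
    if j = σ.state t ∧ valueAt M ε K σ U t j < sampleAt M ε K σ U t
    then sampleAt M ε K σ U t else valueAt M ε K σ U t j :=
  (exec_selected M ε K σ U t (isReady_trace M ε K σ U t)).2.2.1 j

theorem policy_trace_succ (t : ℕ) (j : Fin n) : (trace M ε K σ U (t + 1)).narr .policy j =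
    if j = σ.state t ∧ valueAt M ε K σ U t j < sampleAt M ε K σ U t
    then (σ.action t : ℕ) else (trace M ε K σ U t).narr .policy j :=
  (exec_selected M ε K σ U t (isReady_trace M ε K σ U t)).2.2.2 j

theorem time_trace_le (t : ℕ) : (trace M ε K σ U t).time ≤
    (builtState M).time + (3 + 4 * n) + t * (26 + (17 + 8 * Nat.clog 2 n) * K) := by
  induction t with
  | zero => exact ((startState_spec M ε K).2.1.trans (by simp)).le
  | succ t ih =>
    have := (exec_selected M ε K σ U t (isReady_trace M ε K σ U t)).2.1
    rw [add_mul, one_mul]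
    omega

theorem policy_trace_lt (hm : 0 < m) (t : ℕ) (j : Fin n) :
    (trace M ε K σ U t).narr .policy j < m := by
  induction t with
  | zero => exact ((startState_spec M ε K).2.2.2 j j.isLt).trans_lt hm
  | succ t ih =>
    rw [policy_trace_succ]
    split_ifs
    · exact (σ.action t).isLt
    · exact ih

theorem DMDP.sampleValue_le {ε : ℝ} (hε : 0 ≤ ε) (i : Fin n) (a : Fin m) {w : Fin n → ℝ}
    (hw : ∀ j, w j ≤ (1 - M.γ)⁻¹) (u : ℕ → ℝ) :
    M.sampleValue ε K i a w u ≤ (1 - M.γ)⁻¹ := by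
  have hγ : 0 < 1 - M.γ := sub_pos.2 M.γ_lt_one
  have hK : (0 : ℝ) ≤ K := K.cast_nonneg
  have h1 : (∑ k ∈ Finset.range K, M.r i a (M.next i a (u k))) / K ≤ 1 := by
    refine div_le_of_le_mul₀ hK zero_le_one ?_
    have := Finset.sum_le_card_nsmul (Finset.range K) (fun k => M.r i a (M.next i a (u k))) 1
      fun k _ => (M.r_mem _ _ _).2
    simpa using this
  have h2 : (∑ k ∈ Finset.range K, w (M.next i a (u k))) / K ≤ (1 - M.γ)⁻¹ := by
    refine div_le_of_le_mul₀ hK (inv_nonneg.2 hγ.le) ?_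
    have := Finset.sum_le_card_nsmul (Finset.range K) (fun k => w (M.next i a (u k))) _
      fun k _ => hw _
    rw [mul_comm]
    simpa using this
  have h3 := mul_le_mul_of_nonneg_left h2 M.γ_pos.le
  have h4 : 0 ≤ (1 - M.γ) * ε / 4 := by positivity
  have h5 : 1 + M.γ * (1 - M.γ)⁻¹ = (1 - M.γ)⁻¹ := by field_simp; ring
  rw [DMDP.sampleValue]
  linarith

/-- This holds for every tape and schedule, which supplies the bounded range that Hoeffding's
inequality needs. The lower bound persists because updates only raise entries; strong induction is
used because reads may go far back. -/
theorem valueAt_mem {ε : ℝ} (hε : 0 ≤ ε) (t : ℕ) :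
    ∀ j, valueAt M ε K σ U t j ∈ Set.Icc 0 (1 - M.γ)⁻¹ := by
  have hγ : 0 < 1 - M.γ := sub_pos.2 M.γ_lt_one
  induction t using Nat.strong_induction_on with
  | _ t ih =>
    intro j
    cases t with
    | zero => rw [valueAt_zero]; exact ⟨le_rfl, (inv_pos.2 hγ).le⟩
    | succ t =>
      rw [valueAt_succ]
      have h1 := ih t (by omega) j
      split_ifs with hc
      · refine ⟨h1.1.trans hc.2.le, M.sampleValue_le K hε _ _ (fun l => ?_) _⟩
        refine (ih _ ?_ l).2
        split_ifs <;> omega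
      · exact h1

theorem readAt_mem {ε : ℝ} (hε : 0 ≤ ε) (t : ℕ) (j : Fin n) :
    readAt M ε K σ U t j ∈ Set.Icc 0 (1 - M.γ)⁻¹ :=
  valueAt_mem M K σ U hε _ j

/-- The error of the empirical backup for `(i, a)` computed from the vector `w` and the random
numbers `u`. -/
noncomputable def DMDP.sampleError (M : DMDP n m) (ε : ℝ) (K : ℕ) (i : Fin n) (a : Fin m)
    (w : Fin n → ℝ) (u : ℕ → ℝ) : ℝ :=
  M.sampleValue ε K i a w u + (1 - M.γ) * ε / 4 - M.backup w i a

/-- The subtracted constant turns a two-sided error of `(1 - γ) ε / 4` into an underestimate between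
`0` and `(1 - γ) ε / 2`, as the deterministic convergence argument requires. -/
theorem holdsEpsOptimal_of_sampleError {ε : ℝ} (hm : 0 < m) (hε : 0 < ε) (hε' : ε < (1 - M.γ)⁻¹)
    {B₁ B₂ : ℕ} (hB₁ : 0 < B₁) (hB₂ : 0 < B₂) (hσ : σ.PartiallyAsync B₁ B₂)
    (h : ∀ t < iterationNumber M.γ ε B₁ B₂,
      |M.sampleError ε K (σ.state t) (σ.action t) (readAt M ε K σ U t) (U t)| ≤
        (1 - M.γ) * ε / 4) :
    (run M ε (iterationNumber M.γ ε B₁ B₂) K σ U).HoldsEpsOptimal M ε := by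
  let π : ℕ → Fin n → Fin m := fun t j =>
    ⟨(trace M ε K σ U t).narr .policy j, policy_trace_lt M ε K σ U hm t j⟩
  have hread (t : ℕ) : (fun j => valueAt M ε K σ U (σ.readTime t j) j) = readAt M ε K σ U t := by
    funext j
    rw [readAt, if_pos (hσ.2 j t).2]
  have hI : IsInexactIteration M σ (iterationNumber M.γ ε B₁ B₂) ((1 - M.γ) * ε / 2)
      (valueAt M ε K σ U) π (sampleAt M ε K σ U) := by
    refine ⟨valueAt_zero M ε K σ U, fun t _ => valueAt_succ M ε K σ U t, fun t _ j => ?_,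
      fun t ht => ?_, fun t ht => ?_⟩
    · refine Fin.ext ?_
      have := policy_trace_succ M ε K σ U t j
      rw [apply_ite Fin.val]
      exact this
    · have := (abs_le.1 (h t ht)).2
      rw [DMDP.sampleError] at this
      rw [hread, sampleAt]
      linarith
    · have := (abs_le.1 (h t ht)).1
      rw [DMDP.sampleError] at this
      rw [hread, sampleAt]
      linarith
  exact ⟨π _, fun i => rfl, hI.isEpsOptimal hm hε hε' hB₁ hB₂ hσ⟩

end

section

/-! ## Concentration of the samples -/

/-! ### Measurability tools and freezing of an independent variable -/

section Measurability

/-- Used for quantities evaluated at a random state, pair or read time. The σ-algebra on `Ω` is left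
implicit so that it may be `ℱ t`. -/
theorem measurable_of_countable_index {Ω ι E : Type*} {_ : MeasurableSpace Ω} [MeasurableSpace ι]
    [Countable ι] [MeasurableSingletonClass ι] [MeasurableSpace E] {f : Ω → ι} (hf : Measurable f)
    {F : ι → Ω → E} (hF : ∀ i, Measurable (F i)) : Measurable fun ω => F (f ω) ω := by
  have h : Measurable fun p : ι × Ω => F p.1 p.2 := measurable_from_prod_countable_right hF
  exact h.comp (hf.prodMk measurable_id)

theorem measurable_pi_of_eval {Ω ι E : Type*} {_ : MeasurableSpace Ω} [MeasurableSpace E]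
    {f : Ω → ι → E} (hf : ∀ i, Measurable fun ω => f ω i) : Measurable f :=
  measurable_pi_lambda f hf

/-- If `X` and `Y` are independent, then an event that has probability at most `c` for every frozen
value of `X` has probability at most `c`. -/
theorem measure_le_of_indepFun {Ω α β : Type*} [MeasurableSpace Ω] [MeasurableSpace α]
    [MeasurableSpace β] {μ : Measure Ω} [IsProbabilityMeasure μ] {X : Ω → α} {Y : Ω → β}
    (hX : Measurable X) (hY : Measurable Y) (h : IndepFun X Y μ) {B : Set (α × β)}
    (hB : MeasurableSet B) {c : ENNReal} (hc : ∀ ω', μ {ω | (X ω', Y ω) ∈ B} ≤ c) :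
    μ {ω | (X ω, Y ω) ∈ B} ≤ c := by
  have h1 : μ {ω | (X ω, Y ω) ∈ B} = (μ.map fun ω => (X ω, Y ω)) B :=
    (Measure.map_apply (hX.prodMk hY) hB).symm
  have : IsProbabilityMeasure (μ.map Y) := Measure.isProbabilityMeasure_map hY.aemeasurable
  rw [h1, (indepFun_iff_map_prod_eq_prod_map_map hX.aemeasurable hY.aemeasurable).1 h,
    Measure.prod_apply hB, lintegral_map (measurable_measure_prodMk_left hB) hX]
  calc ∫⁻ ω', (μ.map Y) (Prod.mk (X ω') ⁻¹' B) ∂μ ≤ ∫⁻ _, c ∂μ := by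
        refine lintegral_mono fun ω' => ?_
        rw [Measure.map_apply hY (measurable_prodMk_left hB)]
        exact hc ω'
    _ = c := by simp

end Measurability

variable {n m : ℕ} (M : DMDP n m)

theorem measurable_sampleValue (ε : ℝ) (K : ℕ) :
    Measurable fun p : ((Fin n × Fin m) × (Fin n → ℝ)) × (ℕ → ℝ) =>
      M.sampleValue ε K p.1.1.1 p.1.1.2 p.1.2 p.2 := by
  refine measurable_of_countable_index (f := fun p : ((Fin n × Fin m) × (Fin n → ℝ)) × (ℕ → ℝ) =>
    p.1.1) (F := fun c p => M.sampleValue ε K c.1 c.2 p.1.2 p.2) (by fun_prop) fun c => ?_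
  have hnext (k : ℕ) : Measurable fun p : ((Fin n × Fin m) × (Fin n → ℝ)) × (ℕ → ℝ) =>
      M.next c.1 c.2 (p.2 k) :=
    (M.measurable_next c.1 c.2).comp (by fun_prop)
  have h1 : Measurable fun p : ((Fin n × Fin m) × (Fin n → ℝ)) × (ℕ → ℝ) =>
      ∑ k ∈ Finset.range K, M.r c.1 c.2 (M.next c.1 c.2 (p.2 k)) :=
    Finset.measurable_sum _ fun k _ => (measurable_of_finite (M.r c.1 c.2)).comp (hnext k)
  have h2 : Measurable fun p : ((Fin n × Fin m) × (Fin n → ℝ)) × (ℕ → ℝ) =>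
      ∑ k ∈ Finset.range K, p.1.2 (M.next c.1 c.2 (p.2 k)) :=
    Finset.measurable_sum _ fun k _ => measurable_of_countable_index (hnext k)
      (F := fun j p => p.1.2 j) fun j => by fun_prop
  unfold DMDP.sampleValue
  fun_prop

theorem measurable_backup :
    Measurable fun p : (Fin n × Fin m) × (Fin n → ℝ) => M.backup p.2 p.1.1 p.1.2 := by
  refine measurable_of_countable_index (f := fun p : (Fin n × Fin m) × (Fin n → ℝ) => p.1)
    (F := fun c p => M.backup p.2 c.1 c.2) (by fun_prop) fun c => ?_
  unfold DMDP.backup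
  fun_prop

theorem measurable_sampleError (ε : ℝ) (K : ℕ) :
    Measurable fun p : ((Fin n × Fin m) × (Fin n → ℝ)) × (ℕ → ℝ) =>
      M.sampleError ε K p.1.1.1 p.1.1.2 p.1.2 p.2 :=
  ((measurable_sampleValue M ε K).add_const _).sub ((measurable_backup M).comp measurable_fst)

variable {Ω : Type*} [mΩ : MeasurableSpace Ω] {μ : Measure Ω}

theorem integral_next [IsProbabilityMeasure μ] {V : Ω → ℝ} (hV : Measurable V)
    (hu : pdf.IsUniform V (Set.Icc 0 1) μ volume) (i : Fin n) (a : Fin m) (g : Fin n → ℝ) :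
    ∫ ω, g (M.next i a (V ω)) ∂μ = ∑ j, M.P i a j * g j := by
  have hn : Measurable fun ω => M.next i a (V ω) := (M.measurable_next i a).comp hV
  have : IsProbabilityMeasure (μ.map fun ω => M.next i a (V ω)) :=
    Measure.isProbabilityMeasure_map hn.aemeasurable
  have h1 := integral_map (μ := μ) hn.aemeasurable (f := g)
    (measurable_of_finite g).aestronglyMeasurable
  rw [← h1, integral_fintype .of_finite]
  refine Finset.sum_congr rfl fun j _ => ?_
  have h2 : (μ.map fun ω => M.next i a (V ω)) {j} = ENNReal.ofReal (M.P i a j) := by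
    have hs := M.measurable_next i a (measurableSet_singleton j)
    rw [Measure.map_apply hn (measurableSet_singleton j)]
    change μ (V ⁻¹' (M.next i a ⁻¹' {j})) = _
    rw [← Measure.map_apply hV hs, hu, cond_apply measurableSet_Icc, Real.volume_Icc]
    simp only [sub_zero, ENNReal.ofReal_one, inv_one, one_mul]
    exact M.volume_next_eq i a j
  rw [measureReal_def, h2, ENNReal.toReal_ofReal (M.P_nonneg i a j), smul_eq_mul]

theorem sampleError_eq (ε : ℝ) {K : ℕ} (hK : 0 < K) (i : Fin n) (a : Fin m) (w : Fin n → ℝ)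
    (u : ℕ → ℝ) : K * M.sampleError ε K i a w u = ∑ k ∈ Finset.range K,
      (M.r i a (M.next i a (u k)) + M.γ * w (M.next i a (u k)) - M.backup w i a) := by
  have hK' : (K : ℝ) ≠ 0 := by exact_mod_cast hK.ne'
  rw [Finset.sum_sub_distrib, Finset.sum_add_distrib, ← Finset.mul_sum, Finset.sum_const,
    Finset.card_range, nsmul_eq_mul, DMDP.sampleError, DMDP.sampleValue]
  field_simp
  ring

/-- **Hoeffding's inequality** for the empirical backup. -/
theorem measure_sampleError_le [IsProbabilityMeasure μ] {V : ℕ → Ω → ℝ}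
    (hV : ∀ k, Measurable (V k))
    (hu : ∀ k, pdf.IsUniform (V k) (Set.Icc 0 1) μ volume) (hind : iIndepFun V μ) {ε : ℝ}
    (hε : 0 ≤ ε) {K : ℕ} (hK : 0 < K) (i : Fin n) (a : Fin m) {w : Fin n → ℝ}
    (hw : ∀ j, w j ∈ Set.Icc 0 (1 - M.γ)⁻¹) :
    μ {ω | (1 - M.γ) * ε / 4 < |M.sampleError ε K i a w fun k => V k ω|} ≤
      ENNReal.ofReal (2 * Real.exp (-((1 - M.γ) ^ 4 * ε ^ 2 / 8 * K))) := by
  have hγ : 0 < 1 - M.γ := sub_pos.2 M.γ_lt_one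
  have hK' : (0 : ℝ) < K := by exact_mod_cast hK
  set g : Fin n → ℝ := fun j => M.r i a j + M.γ * w j with hg
  have hgm (j : Fin n) : g j ∈ Set.Icc 0 (1 - M.γ)⁻¹ := by
    have h1 := M.r_mem i a j
    have h2 := mul_le_mul_of_nonneg_left (hw j).2 M.γ_pos.le
    have h3 : 1 + M.γ * (1 - M.γ)⁻¹ = (1 - M.γ)⁻¹ := by field_simp; ring
    exact ⟨add_nonneg h1.1 (mul_nonneg M.γ_pos.le (hw j).1), by
      simp only [hg]; linarith [h1.2]⟩
  have hmeas (k : ℕ) : Measurable fun ω => g (M.next i a (V k ω)) :=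
    (measurable_of_finite g).comp ((M.measurable_next i a).comp (hV k))
  have hE (k : ℕ) : ∫ ω, g (M.next i a (V k ω)) ∂μ = M.backup w i a :=
    integral_next M (hV k) (hu k) i a g
  -- Hoeffding's lemma: a variable with values in an interval of length `(1 - γ)⁻¹` is, once
  -- centred, sub-Gaussian with parameter a quarter of the squared length.
  set c : NNReal := (‖(1 - M.γ)⁻¹ - 0‖₊ / 2) ^ 2 with hc
  have hc' : (c : ℝ) = ((1 - M.γ)⁻¹ / 2) ^ 2 := by
    rw [hc, sub_zero]
    push_cast
    rw [Real.norm_of_nonneg (inv_nonneg.2 hγ.le)]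
  have hsub (k : ℕ) :
      HasSubgaussianMGF (fun ω => g (M.next i a (V k ω)) - M.backup w i a) c μ := by
    have := hasSubgaussianMGF_of_mem_Icc (μ := μ) (hmeas k).aemeasurable
      (.of_forall fun ω => hgm (M.next i a (V k ω)))
    rwa [hE] at this
  have hind' : iIndepFun (fun k ω => g (M.next i a (V k ω)) - M.backup w i a) μ :=
    hind.comp (fun _ u => g (M.next i a u) - M.backup w i a)
      fun _ => ((measurable_of_finite g).comp (M.measurable_next i a)).sub_const _
  have hindn : iIndepFun (fun k ω => -(g (M.next i a (V k ω)) - M.backup w i a)) μ :=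
    hind.comp (fun _ u => -(g (M.next i a u) - M.backup w i a))
      fun _ => (((measurable_of_finite g).comp (M.measurable_next i a)).sub_const _).neg
  have hx : 0 ≤ K * ((1 - M.γ) * ε / 4) := by positivity
  have hexp : -(K * ((1 - M.γ) * ε / 4)) ^ 2 / (2 * K * c) =
      -((1 - M.γ) ^ 4 * ε ^ 2 / 8 * K) := by
    rw [hc']
    field_simp
    ring
  have hp := HasSubgaussianMGF.measure_sum_range_ge_le_of_iIndepFun hind' (n := K)
    (fun k _ => hsub k) hx
  have hn := HasSubgaussianMGF.measure_sum_range_ge_le_of_iIndepFun hindn (n := K)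
    (fun k _ => (hsub k).neg) hx
  rw [hexp] at hp hn
  -- The two one-sided tails together cover the two-sided deviation, whence the factor 2.
  have hsubset : {ω | (1 - M.γ) * ε / 4 < |M.sampleError ε K i a w fun k => V k ω|} ⊆
      {ω | K * ((1 - M.γ) * ε / 4) ≤
        ∑ k ∈ Finset.range K, (g (M.next i a (V k ω)) - M.backup w i a)} ∪
      {ω | K * ((1 - M.γ) * ε / 4) ≤
        ∑ k ∈ Finset.range K, -(g (M.next i a (V k ω)) - M.backup w i a)} := by
    intro ω hω
    have he := sampleError_eq M ε hK i a w fun k => V k ω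
    rw [Set.mem_ofPred_eq, lt_abs] at hω
    simp only [Set.mem_union, Set.mem_ofPred_eq, Finset.sum_neg_distrib, hg]
    rw [← he, ← mul_neg]
    exact hω.imp (fun h => mul_le_mul_of_nonneg_left h.le hK'.le)
      (fun h => mul_le_mul_of_nonneg_left h.le hK'.le)
  refine (ENNReal.le_ofReal_iff_toReal_le (measure_ne_top _ _) (by positivity)).2 ?_
  rw [two_mul]
  exact (measureReal_mono hsubset).trans ((measureReal_union_le _ _).trans (add_le_add hp hn))

/-! ## The success probability of a random run -/

section RandomRun

variable {M} {ℱ : Filtration ℕ mΩ} {σ : Ω → Schedule n m} {U : ℕ → ℕ → Ω → ℝ}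

theorem measurable_readAt_of_valueAt (h : IsRandomRun μ ℱ σ U) (ε : ℝ) (K t : ℕ)
    (ht : ∀ s ≤ t, ∀ j, Measurable[ℱ s] fun ω => valueAt M ε K (σ ω) (fun t k => U t k ω) s j)
    (j : Fin n) : Measurable[ℱ t] fun ω => readAt M ε K (σ ω) (fun t k => U t k ω) t j := by
  have hidx : Measurable[ℱ t] fun ω => if (σ ω).readTime t j ≤ t then (σ ω).readTime t j else 0 :=
    (measurable_of_countable fun s : ℕ => if s ≤ t then s else 0).comp (h.readTime t j)
  have := measurable_of_countable_index hidx
    (F := fun s ω => valueAt M ε K (σ ω) (fun t k => U t k ω) (min s t) j)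
    fun s => (ht _ (min_le_right s t) j).mono (ℱ.mono (min_le_right s t)) le_rfl
  convert this using 2 with ω
  rw [readAt, min_eq_left]
  split_ifs <;> omega

/-- The run is adapted: the vector at `t + 1` is a measurable function of earlier vectors, the
choices of iteration `t` and the numbers `U t`, all known to `ℱ (t + 1)`. -/
theorem measurable_valueAt (h : IsRandomRun μ ℱ σ U) (ε : ℝ) (K t : ℕ) :
    ∀ j, Measurable[ℱ t] fun ω => valueAt M ε K (σ ω) (fun t k => U t k ω) t j := by
  induction t using Nat.strong_induction_on with
  | _ t ih =>
    intro j
    cases t with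
    | zero => simp only [valueAt_zero]; exact measurable_const
    | succ t =>
      have hle : ℱ t ≤ ℱ (t + 1) := ℱ.mono (Nat.le_succ t)
      have hread := measurable_readAt_of_valueAt (M := M) h ε K t fun s hs => ih s (by omega)
      have hq : Measurable[ℱ (t + 1)] fun ω => sampleAt M ε K (σ ω) (fun t k => U t k ω) t :=
        (measurable_sampleValue M ε K).comp
          (((((h.state t).mono hle le_rfl).prodMk ((h.action t).mono hle le_rfl)).prodMk
            (measurable_pi_of_eval fun j => (hread j).mono hle le_rfl)).prodMk
            (measurable_pi_of_eval fun k => h.adapted t k))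
      have hv := (ih t (Nat.lt_succ_self t) j).mono hle le_rfl
      simp only [valueAt_succ]
      refine Measurable.ite (MeasurableSet.inter ?_ (measurableSet_lt hv hq)) hq hv
      exact ((h.state t).mono hle le_rfl)
        (Set.to_countable {i : Fin n | j = i}).measurableSet

theorem measure_sampleError_run_le [IsProbabilityMeasure μ] (h : IsRandomRun μ ℱ σ U) {ε : ℝ}
    (hε : 0 ≤ ε) {K : ℕ} (hK : 0 < K) (t : ℕ) :
    μ {ω | (1 - M.γ) * ε / 4 < |M.sampleError ε K ((σ ω).state t) ((σ ω).action t)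
        (readAt M ε K (σ ω) (fun t k => U t k ω) t) fun k => U t k ω|} ≤
      ENNReal.ofReal (2 * Real.exp (-((1 - M.γ) ^ 4 * ε ^ 2 / 8 * K))) := by
  have hU (k : ℕ) : Measurable (U t k) := (h.adapted t k).mono (ℱ.le _) le_rfl
  let X : Ω → (Fin n × Fin m) × (Fin n → ℝ) := fun ω =>
    (((σ ω).state t, (σ ω).action t), readAt M ε K (σ ω) (fun t k => U t k ω) t)
  let Y : Ω → ℕ → ℝ := fun ω k => U t k ω
  have hX : Measurable[ℱ t] X := ((h.state t).prodMk (h.action t)).prodMk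
    (measurable_pi_of_eval fun j =>
      measurable_readAt_of_valueAt h ε K t (fun s _ => measurable_valueAt h ε K s) j)
  have hY : Measurable Y := measurable_pi_of_eval hU
  have hY' : Measurable[⨆ k, MeasurableSpace.comap (U t k) inferInstance] Y :=
    measurable_pi_of_eval fun k => (comap_measurable (U t k)).mono
      (le_iSup (fun k => MeasurableSpace.comap (U t k) inferInstance) k) le_rfl
  -- The inputs `X` of the iteration are `ℱ t`-measurable and `Y` generates no more than the numbers
  -- `U t`, so freshness makes them independent.
  have hind : IndepFun X Y μ :=
    indep_of_indep_of_le_left (indep_of_indep_of_le_right (h.fresh t).symm hY'.comap_le)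
      hX.comap_le
  refine measure_le_of_indepFun (hX.mono (ℱ.le t) le_rfl) hY hind
    (B := {p | (1 - M.γ) * ε / 4 < |M.sampleError ε K p.1.1.1 p.1.1.2 p.1.2 p.2|})
    (measurableSet_lt measurable_const (measurable_sampleError M ε K).abs) fun ω' => ?_
  -- Only values of `X` attained at some `ω'` are frozen, so the vector obeys the bounds of
  -- `readAt_mem`.
  exact measure_sampleError_le M hU (h.uniform t) (h.iIndep t) hε hK _ _
    fun j => readAt_mem M K (σ ω') _ hε t j

theorem iterationNumber_pos {γ ε : ℝ} (hγ : γ < 1) (hε : 0 < ε) (hε' : ε < (1 - γ)⁻¹) {B₁ B₂ : ℕ}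
    (hB₁ : 0 < B₁) (hB₂ : 0 < B₂) : 0 < iterationNumber γ ε B₁ B₂ := by
  have hγ' : 0 < 1 - γ := sub_pos.2 hγ
  have hεγ : (1 - γ) * ε < 1 := by
    rwa [lt_inv_comm₀ hε hγ', ← one_div, lt_div_iff₀ hε] at hε'
  have hlog : 0 < Real.log (2 / ((1 - γ) * ε)) :=
    Real.log_pos (by rw [lt_div_iff₀ (by positivity)]; linarith)
  have h1 : (1 : ℝ) ≤ B₁ := by exact_mod_cast hB₁
  have h2 : (1 : ℝ) ≤ B₂ := by exact_mod_cast hB₂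
  have h3 : 0 ≤ ((B₁ : ℝ) + B₂ - 1) / (1 - γ) := div_nonneg (by linarith) hγ'.le
  exact Nat.ceil_pos.2 (by nlinarith)

theorem sampleNumber_pos {γ ε δ : ℝ} (hγ : γ < 1) (hε : 0 < ε) (hδ : 0 < δ) (hδ' : δ < 1) {L : ℕ}
    (hL : 0 < L) : 0 < sampleNumber γ ε δ L := by
  have hγ' : 0 < 1 - γ := sub_pos.2 hγ
  have h1 : (1 : ℝ) ≤ L := by exact_mod_cast hL
  refine Nat.ceil_pos.2 (mul_pos (by positivity) (Real.log_pos ?_))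
  rw [lt_div_iff₀ hδ]
  linarith

/-- `K` is the least integer that brings the exponential down to `δ / (4 L)`. The sum is thus even
at most `δ / 2`. -/
theorem mul_exp_sampleNumber_le {γ ε δ : ℝ} (hγ : γ < 1) (hε : 0 < ε) (hδ : 0 < δ) {L : ℕ}
    (hL : 0 < L) :
    L * (2 * Real.exp (-((1 - γ) ^ 4 * ε ^ 2 / 8 * sampleNumber γ ε δ L))) ≤ δ := by
  have hγ' : 0 < 1 - γ := sub_pos.2 hγ
  have hL' : (0 : ℝ) < L := by exact_mod_cast hL
  have h1 : Real.log (4 * L / δ) ≤ (1 - γ) ^ 4 * ε ^ 2 / 8 * sampleNumber γ ε δ L := by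
    have := mul_le_mul_of_nonneg_left
      (Nat.le_ceil (8 / ((1 - γ) ^ 4 * ε ^ 2) * Real.log (4 * L / δ)))
      (show 0 ≤ (1 - γ) ^ 4 * ε ^ 2 / 8 by positivity)
    refine le_trans (le_of_eq ?_) this
    field_simp
  have h2 : Real.exp (-((1 - γ) ^ 4 * ε ^ 2 / 8 * sampleNumber γ ε δ L)) ≤ δ / (4 * L) := by
    calc _ ≤ Real.exp (-Real.log (4 * L / δ)) := Real.exp_le_exp.2 (neg_le_neg h1)
      _ = δ / (4 * L) := by rw [Real.exp_neg, Real.exp_log (by positivity), inv_div]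
  calc L * (2 * Real.exp (-((1 - γ) ^ 4 * ε ^ 2 / 8 * sampleNumber γ ε δ L)))
      ≤ L * (2 * (δ / (4 * L))) := by gcongr
    _ = δ / 2 := by field_simp; ring
    _ ≤ δ := by linarith

theorem ofReal_le_measure_holdsEpsOptimal [IsProbabilityMeasure μ] (h : IsRandomRun μ ℱ σ U)
    (hm : 0 < m) {ε δ : ℝ}
    (hε : 0 < ε) (hε' : ε < (1 - M.γ)⁻¹) (hδ : 0 < δ) (hδ' : δ < 1) {B₁ B₂ : ℕ} (hB₁ : 0 < B₁)
    (hB₂ : 0 < B₂) (hσ : ∀ᵐ ω ∂μ, (σ ω).PartiallyAsync B₁ B₂) :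
    ENNReal.ofReal (1 - δ) ≤ μ {ω | (run M ε (iterationNumber M.γ ε B₁ B₂)
      (sampleNumber M.γ ε δ (iterationNumber M.γ ε B₁ B₂)) (σ ω)
      fun t k => U t k ω).HoldsEpsOptimal M ε} := by
  set L := iterationNumber M.γ ε B₁ B₂ with hL
  set K := sampleNumber M.γ ε δ L with hK
  have hL0 : 0 < L := iterationNumber_pos M.γ_lt_one hε hε' hB₁ hB₂
  have hK0 : 0 < K := sampleNumber_pos M.γ_lt_one hε hδ hδ' hL0
  set bad : ℕ → Set Ω := fun t => {ω | (1 - M.γ) * ε / 4 <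
    |M.sampleError ε K ((σ ω).state t) ((σ ω).action t)
        (readAt M ε K (σ ω) (fun t k => U t k ω) t) fun k => U t k ω|} with hbad
  set good : Set Ω := {ω | (run M ε L K (σ ω) fun t k => U t k ω).HoldsEpsOptimal M ε} with hgood
  have hbound : μ (⋃ t ∈ Finset.range L, bad t) ≤ ENNReal.ofReal δ := by
    calc μ (⋃ t ∈ Finset.range L, bad t) ≤ ∑ t ∈ Finset.range L, μ (bad t) :=
          measure_biUnion_finset_le _ _
      _ ≤ ∑ t ∈ Finset.range L,
          ENNReal.ofReal (2 * Real.exp (-((1 - M.γ) ^ 4 * ε ^ 2 / 8 * K))) :=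
          Finset.sum_le_sum fun t _ => measure_sampleError_run_le h hε.le hK0 t
      _ = ENNReal.ofReal (L * (2 * Real.exp (-((1 - M.γ) ^ 4 * ε ^ 2 / 8 * K)))) := by
          rw [Finset.sum_const, Finset.card_range, nsmul_eq_mul,
            ENNReal.ofReal_mul (Nat.cast_nonneg L), ENNReal.ofReal_natCast]
      _ ≤ ENNReal.ofReal δ :=
          ENNReal.ofReal_le_ofReal (mul_exp_sampleNumber_le M.γ_lt_one hε hδ hL0)
  have hcover : ∀ᵐ ω ∂μ, ω ∈ good ∪ ⋃ t ∈ Finset.range L, bad t := by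
    filter_upwards [hσ] with ω hω
    by_cases hb : ω ∈ ⋃ t ∈ Finset.range L, bad t
    · exact Or.inr hb
    · refine Or.inl (holdsEpsOptimal_of_sampleError M K (σ ω) _ hm hε hε' hB₁ hB₂ hω
        fun t ht => not_lt.1 fun hlt => hb ?_)
      exact Set.mem_biUnion (Finset.mem_coe.2 (Finset.mem_range.2 ht)) hlt
  -- Subadditivity is applied to a cover of almost all of `Ω`, so measurability of `good` is not
  -- needed.
  have hone : (1 : ENNReal) ≤ μ good + ENNReal.ofReal δ := by
    calc (1 : ENNReal) = μ Set.univ := measure_univ.symm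
      _ ≤ μ (good ∪ ⋃ t ∈ Finset.range L, bad t) :=
          measure_mono_ae (hcover.mono fun ω hω _ => hω)
      _ ≤ μ good + μ (⋃ t ∈ Finset.range L, bad t) := measure_union_le _ _
      _ ≤ μ good + ENNReal.ofReal δ := by gcongr
  rw [ENNReal.ofReal_sub _ hδ.le, ENNReal.ofReal_one]
  exact tsub_le_iff_right.2 hone

end RandomRun

end

section

/-! ## The cost of a run -/

theorem one_le_log_two_add {f : ℝ} (hf : 1 ≤ f) : 1 ≤ Real.log (2 + f) := by
  rw [Real.le_log_iff_exp_le (by linarith)]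
  linarith [Real.exp_one_lt_three]

theorem half_le_log {x : ℝ} (hx : 2 ≤ x) : 1 / 2 ≤ Real.log x :=
  le_trans (by linarith [Real.log_two_gt_d9]) (Real.log_le_log (by norm_num) hx)

theorem le_softO {p : ℕ} {f : ℝ} (hf : 1 ≤ f) : f ≤ softO p f :=
  le_mul_of_one_le_right (by linarith) (one_le_pow₀ (one_le_log_two_add hf))

/-- Rounding up costs at most 1, and `1 / log 2 ≤ 2`. As `log (2 + f) ≥ 1`, the factor 3 absorbs
both. -/
theorem clog_two_le {n : ℕ} (hn : 0 < n) {f : ℝ} (hf : (n : ℝ) ≤ f) :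
    (Nat.clog 2 n : ℝ) ≤ 3 * Real.log (2 + f) := by
  have hn' : (1 : ℝ) ≤ n := by exact_mod_cast hn
  have hlog := one_le_log_two_add (hn'.trans hf)
  rcases Nat.lt_or_ge 1 n with h1 | h1
  · have hpow := Nat.pow_pred_clog_lt_self one_lt_two h1
    have hpos : 0 < Nat.clog 2 n := Nat.clog_pos one_lt_two h1
    obtain ⟨d, hd⟩ : ∃ d, Nat.clog 2 n = d + 1 := ⟨_, (Nat.succ_pred_eq_of_pos hpos).symm⟩
    rw [hd, Nat.pred_succ] at hpow
    have h2 : (d : ℝ) * Real.log 2 ≤ Real.log n := by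
      rw [← Real.log_pow]
      exact Real.log_le_log (by positivity) (by exact_mod_cast hpow.le)
    have h3 : Real.log n ≤ Real.log (2 + f) := Real.log_le_log (by linarith) (by linarith)
    have h4 : (d : ℝ) * (1 / 2) ≤ d * Real.log 2 :=
      mul_le_mul_of_nonneg_left (half_le_log le_rfl) d.cast_nonneg
    rw [hd]
    push_cast
    linarith
  · have : n = 1 := by omega
    rw [this, Nat.clog_one_right]
    push_cast
    linarith

theorem iterationNumber_le {γ ε : ℝ} (hγ : 0 < γ) (hγ' : γ < 1) (hε : 0 < ε)
    (hε' : ε < (1 - γ)⁻¹) {B₁ B₂ : ℕ} (hB₁ : 0 < B₁) (hB₂ : 0 < B₂) {c N f : ℝ} (hc : 1 ≤ c)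
    (hN : 1 ≤ N) (hB : (B₁ : ℝ) + B₂ ≤ c * N) (hf : 1 ≤ f)
    (hxy : ((1 - γ)⁻¹ * ε⁻¹) ^ 2 ≤ 2 * f) :
    (iterationNumber γ ε B₁ B₂ : ℝ) ≤ 14 * c * N * (1 - γ)⁻¹ * Real.log (2 + f) := by
  have hg : 0 < 1 - γ := sub_pos.2 hγ'
  have hx : 1 ≤ (1 - γ)⁻¹ := (one_le_inv₀ hg).2 (by linarith)
  have hxy1 : 1 ≤ (1 - γ)⁻¹ * ε⁻¹ := by
    rw [← div_eq_mul_inv, le_div_iff₀ hε]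
    linarith
  have hlog := one_le_log_two_add hf
  set x := (1 - γ)⁻¹ with hxdef
  set l := Real.log (2 / ((1 - γ) * ε)) with hl
  have harg : 2 / ((1 - γ) * ε) = 2 * (x * ε⁻¹) := by rw [hxdef]; field_simp
  have hl1 : 1 / 2 ≤ l := half_le_log (by rw [harg]; linarith)
  -- The bound on `((1 - γ)⁻¹ ε⁻¹)²` makes the argument of the logarithm at most `(2 + f)²`.
  have hl2 : l ≤ 2 * Real.log (2 + f) := by
    have : l ≤ Real.log ((2 + f) ^ 2) := by
      rw [hl, harg]
      exact Real.log_le_log (by positivity) (by nlinarith)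
    rwa [Real.log_pow] at this
  have h1 : (1 : ℝ) ≤ B₁ := by exact_mod_cast hB₁
  have h2 : (1 : ℝ) ≤ B₂ := by exact_mod_cast hB₂
  have hnn : 0 ≤ 2 * (B₁ : ℝ) + ((B₁ : ℝ) + B₂ - 1) / (1 - γ) * l :=
    add_nonneg (by linarith) (mul_nonneg (div_nonneg (by linarith) hg.le) (by linarith))
  have hceil := (Nat.ceil_lt_add_one hnn).le
  have hcN : 1 ≤ c * N := one_le_mul_of_one_le_of_one_le hc hN
  have hcNx : c * N ≤ c * N * x := le_mul_of_one_le_right (by linarith) hx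
  have h3 : ((B₁ : ℝ) + B₂ - 1) / (1 - γ) * l ≤ c * N * x * l := by
    rw [div_eq_mul_inv, ← hxdef]
    have : (B₁ : ℝ) + B₂ - 1 ≤ c * N := by linarith
    gcongr
  calc (iterationNumber γ ε B₁ B₂ : ℝ)
      ≤ 2 * (B₁ : ℝ) + ((B₁ : ℝ) + B₂ - 1) / (1 - γ) * l + 1 := hceil
    -- Since `l ≥ 1 / 2`, the term `2 B₁` contributes 4, the main term 1 and the rounding 2.
    _ ≤ 7 * (c * N * x * l) := by nlinarith
    _ ≤ 7 * (c * N * x * (2 * Real.log (2 + f))) := by gcongr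
    _ = 14 * c * N * x * Real.log (2 + f) := by ring

theorem sampleNumber_le {γ ε δ : ℝ} (hγ' : γ < 1) (hε : 0 < ε) (hδ : 0 < δ)
    {L : ℕ} (hL : 0 < L) {c f : ℝ} (hc : 1 ≤ c) (hf : 1 ≤ f)
    (hx : 1 ≤ ((1 - γ)⁻¹) ^ 4 * ε⁻¹ ^ 2) (hl : 1 / 2 ≤ Real.log (2 / δ))
    (hLf : 2 * (L : ℝ) ≤ 56 * c * (2 + f) ^ 2) :
    (sampleNumber γ ε δ L : ℝ) ≤ (16 * Real.log (56 * c) + 42) *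
      (((1 - γ)⁻¹) ^ 4 * ε⁻¹ ^ 2 * Real.log (2 / δ)) * Real.log (2 + f) := by
  have hg : 0 < 1 - γ := sub_pos.2 hγ'
  have hlog := one_le_log_two_add hf
  have hL' : (1 : ℝ) ≤ L := by exact_mod_cast hL
  set l := Real.log (2 / δ) with hldef
  set Λ := Real.log (2 + f) with hΛ
  set X := ((1 - γ)⁻¹) ^ 4 * ε⁻¹ ^ 2 with hX
  have hc0 : 0 ≤ Real.log (56 * c) := Real.log_nonneg (by linarith)
  -- Splitting off `log (2 / δ)` keeps `δ` out of the logarithmic factor: it enters the final bound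
  -- linearly.
  have h1 : Real.log (4 * L / δ) = Real.log (2 * L) + l := by
    rw [hldef, ← Real.log_mul (by positivity) (by positivity)]
    congr 1
    ring
  have h2 : Real.log (2 * L) ≤ Real.log (56 * c) + 2 * Λ := by
    have e : Real.log (56 * c * (2 + f) ^ 2) = Real.log (56 * c) + 2 * Λ := by
      rw [Real.log_mul (by positivity) (by positivity), Real.log_pow]; norm_num [hΛ]
    exact (Real.log_le_log (by linarith) hLf).trans_eq e
  have h3 : 0 ≤ Real.log (2 * L) := Real.log_nonneg (by linarith)
  have h4 : 8 / ((1 - γ) ^ 4 * ε ^ 2) = 8 * X := by rw [hX]; field_simp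
  have hlΛ : 1 / 2 ≤ l * Λ := by nlinarith
  have h5 : Real.log (4 * L / δ) ≤ (2 * Real.log (56 * c) + 5) * (l * Λ) := by
    rw [h1]
    have e1 : Real.log (56 * c) ≤ Real.log (56 * c) * (2 * (l * Λ)) :=
      le_mul_of_one_le_right hc0 (by linarith)
    have e2 : 2 * Λ ≤ 4 * (l * Λ) := by nlinarith
    have e3 : l ≤ l * Λ := le_mul_of_one_le_right (by linarith) hlog
    linarith
  have h6 : 0 ≤ Real.log (4 * L / δ) := by rw [h1]; linarith
  have hceil := (Nat.ceil_lt_add_one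
    (mul_nonneg (show 0 ≤ 8 / ((1 - γ) ^ 4 * ε ^ 2) by positivity) h6)).le
  have h7 : 1 ≤ 2 * (X * (l * Λ)) := by nlinarith
  calc (sampleNumber γ ε δ L : ℝ) ≤ 8 / ((1 - γ) ^ 4 * ε ^ 2) * Real.log (4 * L / δ) + 1 := hceil
    _ ≤ 8 * X * ((2 * Real.log (56 * c) + 5) * (l * Λ)) + 2 * (X * (l * Λ)) := by
        rw [h4]; gcongr
    _ = (16 * Real.log (56 * c) + 42) * (X * l) * Λ := by ring

/-- The constant in the cost bound when `B₁ + B₂ ≤ c n m`. -/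
noncomputable def costConstant (c : ℝ) : ℝ :=
  35 + 14 * c * (52 + 41 * (16 * Real.log (56 * c) + 42))

theorem le_costConstant {c : ℝ} (hc : 1 ≤ c) : 35 ≤ costConstant c := by
  have : 0 ≤ Real.log (56 * c) := Real.log_nonneg (by linarith)
  have : 0 ≤ 14 * c * (52 + 41 * (16 * Real.log (56 * c) + 42)) := by positivity
  rw [costConstant]
  linarith

variable {n m : ℕ} (M : DMDP n m)

theorem one_le_sq_mul (hn : 0 < n) (hm : 0 < m) : (1 : ℝ) ≤ (n : ℝ) ^ 2 * m :=
  one_le_mul_of_one_le_of_one_le (one_le_pow₀ (by exact_mod_cast hn)) (by exact_mod_cast hm)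

theorem time_builtState_le (hn : 0 < n) (hm : 0 < m) :
    ((builtState M).time : ℝ) ≤ 27 * ((n : ℝ) ^ 2 * m) := by
  have h : (((builtState M).time : ℕ) : ℝ) ≤ ((4 + (8 + (8 + 7 * n) * m) * n : ℕ) : ℝ) :=
    Nat.cast_le.2 (builtState_spec M).2.2
  push_cast at h
  have hn' : (1 : ℝ) ≤ n := by exact_mod_cast hn
  have hm' : (1 : ℝ) ≤ m := by exact_mod_cast hm
  have h1 := one_le_sq_mul hn hm
  have h2 : (n : ℝ) * m ≤ (n : ℝ) ^ 2 * m := by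
    rw [sq]; gcongr; exact le_mul_of_one_le_right (by linarith) hn'
  have h3 : (n : ℝ) ≤ n * m := le_mul_of_one_le_right (by linarith) hm'
  nlinarith

theorem time_callState_le (hn : 0 < n) (hm : 0 < m) (i : Fin n) (a : Fin m) (u : ℝ) :
    ((callState M i a u).time : ℝ) - (builtState M).time ≤ 35 * Real.log (2 + n * m) ^ 3 := by
  have hn' : (1 : ℝ) ≤ n := by exact_mod_cast hn
  have hm' : (1 : ℝ) ≤ m := by exact_mod_cast hm
  have h1 : (n : ℝ) ≤ n * m := le_mul_of_one_le_right (by linarith) hm'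
  have h2 := clog_two_le hn h1
  have h3 := one_le_log_two_add (hn'.trans h1)
  have h4 := le_self_pow₀ h3 (three_ne_zero)
  rw [(callState_spec M i a u).2.2]
  push_cast
  linarith

set_option maxHeartbeats 400000 in
-- The exponent 3 counts one logarithm each from `L`, from `K` and from the depth of the bisection.
-- All are bounded by `log (2 + f)` because `f` dominates `n`, `N x` and `(x y)²` up to a constant;
-- this uses `x y ≥ 1`, that is `ε ≤ (1 - γ)⁻¹`, and `log (2 / δ) ≥ 1 / 2`.
theorem time_run_le (hn : 0 < n) (hm : 0 < m) {ε δ : ℝ} (hε : 0 < ε) (hε' : ε < (1 - M.γ)⁻¹)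
    (hδ : 0 < δ) (hδ' : δ < 1) {B₁ B₂ : ℕ} (hB₁ : 0 < B₁) (hB₂ : 0 < B₂) {c : ℝ} (hc : 1 ≤ c)
    (hB : (B₁ : ℝ) + B₂ ≤ c * (n * m)) (σ : Schedule n m) (U : ℕ → ℕ → ℝ) :
    ((run M ε (iterationNumber M.γ ε B₁ B₂)
      (sampleNumber M.γ ε δ (iterationNumber M.γ ε B₁ B₂)) σ U).time : ℝ) ≤
      costConstant c * softO 3 ((n : ℝ) ^ 2 * m +
        n * m / ((1 - M.γ) ^ 5 * ε ^ 2) * Real.log (2 / δ)) := by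
  have hg : 0 < 1 - M.γ := sub_pos.2 M.γ_lt_one
  have hL0 := iterationNumber_pos M.γ_lt_one hε hε' hB₁ hB₂
  set L := iterationNumber M.γ ε B₁ B₂ with hL
  set K := sampleNumber M.γ ε δ L with hK
  set x := (1 - M.γ)⁻¹ with hx
  set y := ε⁻¹ with hy
  set l := Real.log (2 / δ) with hl
  have hl1 : 1 / 2 ≤ l := half_le_log (by rw [le_div_iff₀ hδ]; linarith)
  have hn' : (1 : ℝ) ≤ n := by exact_mod_cast hn
  have hm' : (1 : ℝ) ≤ m := by exact_mod_cast hm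
  set N : ℝ := n * m with hN
  have hN1 : 1 ≤ N := one_le_mul_of_one_le_of_one_le hn' hm'
  have hnm : (n : ℝ) ≤ n ^ 2 * m := by
    rw [sq, mul_assoc]; exact le_mul_of_one_le_right (by linarith) hN1
  have hx1 : 1 ≤ x := (one_le_inv₀ hg).2 (by linarith [M.γ_pos])
  have hy0 : 0 < y := inv_pos.2 hε
  have hxy : 1 ≤ x * y := by
    rw [hy, ← div_eq_mul_inv, le_div_iff₀ hε]
    linarith
  have hxy2 : 1 ≤ (x * y) ^ 2 := one_le_pow₀ hxy
  set G := N * (x ^ 5 * y ^ 2) * l with hG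
  have hGeq : N / ((1 - M.γ) ^ 5 * ε ^ 2) * l = G := by
    rw [hG, hx, hy]; field_simp
  have hmain : N * x * (x * y) ^ 2 ≤ 2 * G := by
    have e1 : N * x * (x * y) ^ 2 ≤ N * x * (x * y) ^ 2 * x ^ 2 :=
      le_mul_of_one_le_right (by positivity) (one_le_pow₀ hx1)
    have e2 : N * x * (x * y) ^ 2 * x ^ 2 ≤ N * x * (x * y) ^ 2 * x ^ 2 * (2 * l) :=
      le_mul_of_one_le_right (by positivity) (by linarith)
    refine (e1.trans e2).trans_eq ?_
    rw [hG]; ring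
  have hNx1 : 1 ≤ N * x := one_le_mul_of_one_le_of_one_le hN1 hx1
  rw [hGeq]
  set f := (n : ℝ) ^ 2 * m + G with hf
  have hG0 : 0 ≤ G := by positivity
  have h0 := one_le_sq_mul hn hm
  have hf1 : 1 ≤ f := by linarith
  have hNx : N * x ≤ 2 * f := by
    have : N * x ≤ N * x * (x * y) ^ 2 := le_mul_of_one_le_right (by linarith) hxy2
    linarith
  have hxyf : (x * y) ^ 2 ≤ 2 * f := by
    have : (x * y) ^ 2 ≤ N * x * (x * y) ^ 2 := le_mul_of_one_le_left (by positivity) hNx1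
    linarith
  set Λ := Real.log (2 + f) with hΛ
  have hΛ1 : 1 ≤ Λ := one_le_log_two_add hf1
  have hΛf : Λ ≤ 2 + f := (Real.log_le_sub_one_of_pos (by linarith)).trans (by linarith)
  have hLle : (L : ℝ) ≤ 14 * c * N * x * Λ :=
    iterationNumber_le M.γ_pos M.γ_lt_one hε hε' hB₁ hB₂ hc hN1 hB hf1 hxyf
  -- The crude estimate `Λ ≤ 2 + f` makes `L` at most quadratic in `2 + f`, so that `log L` is again
  -- of order `Λ`.
  have hLf : 2 * (L : ℝ) ≤ 56 * c * (2 + f) ^ 2 := by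
    have e1 : 14 * c * N * x * Λ ≤ 14 * c * (2 * f) * (2 + f) := by
      rw [mul_assoc (14 * c) N x]; gcongr
    have e2 : 56 * c * (f * (2 + f)) ≤ 56 * c * (2 + f) ^ 2 := by
      rw [sq]; gcongr; linarith only
    linarith only [hLle, e1, e2]
  have hX1 : 1 ≤ x ^ 4 * y ^ 2 := by
    have : (x * y) ^ 2 ≤ (x * y) ^ 2 * x ^ 2 :=
      le_mul_of_one_le_right (by positivity) (one_le_pow₀ hx1)
    calc 1 ≤ (x * y) ^ 2 * x ^ 2 := hxy2.trans this
      _ = x ^ 4 * y ^ 2 := by ring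
  have hKle : (K : ℝ) ≤ (16 * Real.log (56 * c) + 42) * (x ^ 4 * y ^ 2 * l) * Λ :=
    sampleNumber_le M.γ_lt_one hε hδ hL0 hc hf1 hX1 hl1 hLf
  set c₃ := 16 * Real.log (56 * c) + 42 with hc₃
  have hc₃0 : 0 ≤ c₃ := by
    have : 0 ≤ Real.log (56 * c) := Real.log_nonneg (by linarith)
    positivity
  set Z := x ^ 4 * y ^ 2 * l with hZ
  have hlZ : l ≤ Z := le_mul_of_one_le_left (by linarith only [hl1]) hX1
  have hZ1 : 1 ≤ 2 * Z := by linarith only [hlZ, hl1]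
  have hd := clog_two_le hn (hnm.trans (show (n : ℝ) ^ 2 * m ≤ f by linarith))
  have hinner : 26 + (17 + 8 * (Nat.clog 2 n : ℝ)) * K ≤ (52 + 41 * c₃) * Z * Λ ^ 2 := by
    have e1 : 17 + 8 * (Nat.clog 2 n : ℝ) ≤ 41 * Λ := by linarith
    have e2 : (17 + 8 * (Nat.clog 2 n : ℝ)) * K ≤ 41 * Λ * (c₃ * Z * Λ) := by gcongr
    have e3 : 26 ≤ 52 * Z * Λ ^ 2 := by
      have : 2 * Z ≤ 2 * Z * Λ ^ 2 := le_mul_of_one_le_right (by linarith) (one_le_pow₀ hΛ1)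
      linarith
    calc _ ≤ 52 * Z * Λ ^ 2 + 41 * Λ * (c₃ * Z * Λ) := add_le_add e3 e2
      _ = _ := by ring
  have htime : ((run M ε L K σ U).time : ℝ) ≤ (builtState M).time + (3 + 4 * n) +
      L * (26 + (17 + 8 * Nat.clog 2 n) * K) := by
    exact_mod_cast time_trace_le M ε K σ U L
  have hb := time_builtState_le M hn hm
  have hfl : f ≤ f * Λ ^ 3 := le_softO (p := 3) hf1
  have hloop : (L : ℝ) * (26 + (17 + 8 * Nat.clog 2 n) * K) ≤
      14 * c * (52 + 41 * c₃) * (f * Λ ^ 3) := by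
    calc (L : ℝ) * (26 + (17 + 8 * Nat.clog 2 n) * K)
        ≤ 14 * c * N * x * Λ * ((52 + 41 * c₃) * Z * Λ ^ 2) := by gcongr
      -- The factor `N x` from `L` and the factor `Z` from `K` multiply to `G`.
      _ = 14 * c * (52 + 41 * c₃) * (G * Λ ^ 3) := by rw [hZ, hG]; ring
      _ ≤ 14 * c * (52 + 41 * c₃) * (f * Λ ^ 3) := by
          have hGf : G ≤ f := by rw [hf]; linarith only [h0]
          gcongr
  have hfixed : 27 * ((n : ℝ) ^ 2 * m) + (3 + 4 * n) ≤ 35 * (f * Λ ^ 3) := by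
    have hle : (n : ℝ) ^ 2 * m ≤ f := by rw [hf]; linarith only [hG0]
    linarith only [hle, hfl, h0, hnm]
  calc ((run M ε L K σ U).time : ℝ)
      ≤ 27 * ((n : ℝ) ^ 2 * m) + (3 + 4 * n) + 14 * c * (52 + 41 * c₃) * (f * Λ ^ 3) := by
        linarith only [htime, hb, hloop]
    _ ≤ 35 * (f * Λ ^ 3) + 14 * c * (52 + 41 * c₃) * (f * Λ ^ 3) := by linarith only [hfixed]
    _ = costConstant c * softO 3 f := by rw [costConstant, softO]; ring

end

end AsyncQVI

/-! ### The corollary -/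

theorem mainTheorem4 :
    ∃ p : ℕ, ∀ C₀ : ℝ, ∃ C : ℝ, ∀ (n m : ℕ), 0 < n → 0 < m → ∀ M : DMDP n m,
      -- preprocessing time
      ((builtState M).time : ℝ) ≤ C * softO p ((n : ℝ) ^ 2 * m) ∧
      -- what has been built is a generative model
      (∀ (i : Fin n) (a : Fin m),
        (∀ j : Fin n, volume {u : ℝ | u ∈ Set.Icc (0 : ℝ) 1 ∧ (callState M i a u).nreg .lo = j} =
          ENNReal.ofReal (M.P i a j)) ∧
        (∀ u ∈ Set.Icc (0 : ℝ) 1, ∃ j : Fin n, (callState M i a u).nreg .lo = j ∧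
          (callState M i a u).rreg .rew = M.r i a j ∧
          ((callState M i a u).time : ℝ) - (builtState M).time ≤
            C * Real.log (2 + n * m) ^ p)) ∧
      -- AsyncQVI
      ∀ (ε δ : ℝ), 0 < ε → ε < (1 - M.γ)⁻¹ → 0 < δ → δ < 1 →
      ∀ (B₁ B₂ : ℕ), 0 < B₁ → 0 < B₂ → (B₁ : ℝ) + B₂ ≤ C₀ * (n * m) →
      ∀ (L K : ℕ), L = iterationNumber M.γ ε B₁ B₂ → K = sampleNumber M.γ ε δ L →
      ∀ (Ω : Type*) [mΩ : MeasurableSpace Ω] (μ : Measure Ω) [IsProbabilityMeasure μ]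
        (ℱ : Filtration ℕ mΩ) (σ : Ω → Schedule n m) (U : ℕ → ℕ → Ω → ℝ),
        IsRandomRun μ ℱ σ U → (∀ᵐ ω ∂μ, (σ ω).PartiallyAsync B₁ B₂) →
        ENNReal.ofReal (1 - δ) ≤
          μ {ω | (run M ε L K (σ ω) fun t k => U t k ω).HoldsEpsOptimal M ε} ∧
        ∀ ω, ((run M ε L K (σ ω) fun t k => U t k ω).time : ℝ) ≤
          C * softO p ((n : ℝ) ^ 2 * m +
            n * m / ((1 - M.γ) ^ 5 * ε ^ 2) * Real.log (2 / δ)) := by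
  -- The cost estimates need a factor of at least 1, hence `max C₀ 1`.
  refine ⟨3, fun C₀ => ⟨costConstant (max C₀ 1), fun n m hn hm M => ?_⟩⟩
  have hc : 35 ≤ costConstant (max C₀ 1) := le_costConstant (le_max_right _ _)
  have hn' : (1 : ℝ) ≤ n := by exact_mod_cast hn
  have hm' : (1 : ℝ) ≤ m := by exact_mod_cast hm
  have hlog : 1 ≤ Real.log (2 + n * m) :=
    one_le_log_two_add (one_le_mul_of_one_le_of_one_le hn' hm')
  refine ⟨?_, fun i a => ⟨fun j => ?_, fun u _ => ⟨M.next i a u, ?_, ?_, ?_⟩⟩, ?_⟩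
  · have h1 := le_softO (p := 3) (one_le_sq_mul hn hm)
    refine (time_builtState_le M hn hm).trans ?_
    exact mul_le_mul (by linarith) h1 (by positivity) (by linarith)
  · simp only [(callState_spec M i a _).1, ← Fin.ext_iff]
    exact M.volume_next_eq i a j
  · exact (callState_spec M i a u).1
  · exact (callState_spec M i a u).2.1
  · exact (time_callState_le M hn hm i a u).trans
      (mul_le_mul_of_nonneg_right hc (pow_nonneg (by linarith) 3))
  · intro ε δ hε hε' hδ hδ' B₁ B₂ hB₁ hB₂ hB L K hL hK Ω mΩ μ hμ ℱ σ U hrun hσ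
    subst hL hK
    refine ⟨ofReal_le_measure_holdsEpsOptimal hrun hm hε hε' hδ hδ' hB₁ hB₂ hσ, fun ω => ?_⟩
    refine time_run_le M hn hm hε hε' hδ hδ' hB₁ hB₂ (le_max_right C₀ 1) (hB.trans ?_) _ _
    exact mul_le_mul_of_nonneg_right (le_max_left C₀ 1) (by positivity)
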